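/- Let $r\ge 1$ be an integer. An $r$-graph $G$ is a finite vertex set $V(G)$ with a set $E(G)$ of $r$-element subsets of $V(G)$; $\delta(G)$ is its minimum degree. For real $\alpha>1$ put $P_G(\mathbf x)=r!\sum_{e\in E(G)}\prod_{i\in e}x_i$, $\|\mathbf x\|_\alpha=\big(\sum_i|x_i|^\alpha\big)^{1/\alpha}$ and $\lambda^{(\alpha)}(G)=\max_{\|\mathbf x\|_\alpha=1}P_G(\mathbf x)$. A principal eigenvector of $G$ is a vector $\mathbf x$ with nonnegative entries, $\|\mathbf x\|_\alpha=1$ and $P_G(\mathbf x)=\lambda^{(\alpha)}(G)$, and $x_{\min}(G)$ is the infimum, over all principal eigenvectors $\mathbf x$ of $G$, of the smallest entry of $\mathbf x$. An $r$-pattern is a pair $P=([l],E)$ where $l$ is a positive integer and $E$ is a set of $r$-multisets with elements from $[l]$. An $r$-graph $H$ is $P$-colorable if there is a map $\phi:V(H)\to[l]$ such that the multiset $\{\phi(v_1),\dots,\phi(v_r)\}$ belongs to $E$ for every edge $\{v_1,\dots,v_r\}$ of $H$. Let $Col(P)$ be the family of $P$-colorable $r$-graphs, let $ex(Col(P),n)$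 and $\lambda^{(\alpha)}(Col(P),n)$ be the maximum number of edges and the maximum of $\lambda^{(\alpha)}$ among $n$-vertex members of $Col(P)$, and let $\pi(Col(P))=\lim_{n\to\infty}ex(Col(P),n)/\binom nr$. **Theorem.** Let $P=([l],E)$ be an $r$-pattern with $E\neq\emptyset$ and let $\alpha>1$. Then the limit $\pi(Col(P))$ exists, and there are $n_1\in\mathbb N$ and a constant $M>0$, depending only on $P$ and $\alpha$, such that for all $n\ge n_1$ and all $r$-graphs $G_n,G_{n+1}\in Col(P)$ on $n$ and $n+1$ vertices with $\lambda^{(\alpha)}(G_n)=\lambda^{(\alpha)}(Col(P),n)$ and $\lambda^{(\alpha)}(G_{n+1})=\lambda^{(\alpha)}(Col(P),n+1)$: 1. $\lambda^{(\alpha)}(G_{n+1})\ge\Big(1+r\Big(1-\frac1\alpha-\frac{l}{\alpha(n-lr+l)}\Big)\,x_{\min}(G_n)^{\alpha}\Big)\lambda^{(\alpha)}(G_n)$; 2. $x_{\min}(G_n)^{\alpha}\ge\frac1n\Big(1-\frac{\pi(Col(P))\,M}{rn}\Big)$; 3. $\delta(G_n)\ge\pi(Col(P))\Big(1-\frac Mn\Big)\binom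 n{r-1}$. -/

import Mathlib

open Filter Topology

noncomputable section

/-- An `r`-graph with vertex set `V`: a set of edges, each consisting of exactly `r` vertices. -/
@[ext]
structure UniformHypergraph (V : Type*) (r : ℕ) where
  edges : Finset (Finset V)
  uniform : ∀ e ∈ edges, e.card = r

/-- An `r`-pattern `([l], E)`: a positive integer `l` and a set `E` of `r`-multisets
with elements from an `l`-element set. -/
structure Pattern (r : ℕ) where
  l : ℕ
  l_pos : 0 < l
  E : Set (Sym (Fin l) r)

namespace UniformHypergraph

variable {V : Type*} {r : ℕ}

/-- `φ` maps every edge `{v₁, …, v_r}` to an `r`-multiset `{φ v₁, …, φ v_r}` in `E`. -/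
def IsHom (G : UniformHypergraph V r) (P : Pattern r) (φ : V → Fin P.l) : Prop :=
  ∀ e ∈ G.edges, ∃ s ∈ P.E, (s : Multiset (Fin P.l)) = e.val.map φ

def IsColorable (G : UniformHypergraph V r) (P : Pattern r) : Prop :=
  ∃ φ : V → Fin P.l, G.IsHom P φ

open Classical in
/-- The number of edges containing `v`. -/
def degree (G : UniformHypergraph V r) (v : V) : ℕ :=
  (G.edges.filter fun e => v ∈ e).card

/-- The minimum degree. -/
def minDegree (G : UniformHypergraph V r) : ℕ := ⨅ v : V, G.degree v

/-- The Lagrangian polynomial `P_G(x) = r! ∑_{e ∈ E(G)} ∏_{i ∈ e} x i`. -/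
def lagrangian (G : UniformHypergraph V r) (x : V → ℝ) : ℝ :=
  (r.factorial : ℝ) * ∑ e ∈ G.edges, ∏ i ∈ e, x i

end UniformHypergraph

/-- The norm `(∑ |x i| ^ α) ^ (1 / α)`. -/
def alphaNorm {V : Type*} [Fintype V] (α : ℝ) (x : V → ℝ) : ℝ :=
  (∑ i, |x i| ^ α) ^ (1 / α)

namespace UniformHypergraph

variable {V : Type*} [Fintype V] {r : ℕ}

/-- The `α`-spectral radius, the maximum of the Lagrangian polynomial over the unit sphere
of the `α`-norm (for nonempty `V`, a continuous function on a nonempty compact set). -/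
def spectralRadius (α : ℝ) (G : UniformHypergraph V r) : ℝ :=
  sSup (G.lagrangian '' {x | alphaNorm α x = 1})

/-- Principal eigenvectors: nonnegative unit vectors at which the maximum is attained. -/
def principalEigenvectors (α : ℝ) (G : UniformHypergraph V r) : Set (V → ℝ) :=
  {x | (∀ i, 0 ≤ x i) ∧ alphaNorm α x = 1 ∧ G.lagrangian x = G.spectralRadius α}

/-- `x_min(G)`: the infimum over all principal eigenvectors of the minimum component. -/
def xMin (α : ℝ) (G : UniformHypergraph V r) : ℝ :=
  sInf ((fun x : V → ℝ => ⨅ i, x i) '' G.principalEigenvectors α)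

end UniformHypergraph

/-- The `P`-colorable `r`-graphs of order `n`. -/
def Col {r : ℕ} (P : Pattern r) (n : ℕ) : Set (UniformHypergraph (Fin n) r) :=
  {G | G.IsColorable P}

/-- `ex(F, n)`: the largest number of edges of an `n`-vertex member of `F`. -/
def exNumber {r : ℕ} (F : ∀ n, Set (UniformHypergraph (Fin n) r)) (n : ℕ) : ℕ :=
  sSup ((fun G => G.edges.card) '' F n)

/-- `π(F)`: the limit of `ex(F, n) / binom(n, r)`. -/
def edgeDensity {r : ℕ} (F : ∀ n, Set (UniformHypergraph (Fin n) r)) : ℝ :=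
  limUnder atTop fun n : ℕ => (exNumber F n : ℝ) / (n.choose r : ℝ)

/-- `λ^(α)(F, n)`: the largest `α`-spectral radius of an `n`-vertex member of `F`. -/
def maxSpectralRadius {r : ℕ} (α : ℝ) (F : ∀ n, Set (UniformHypergraph (Fin n) r))
    (n : ℕ) : ℝ :=
  sSup ((fun G => G.spectralRadius α) '' F n)

/-- The `n`-vertex members of `F` with the largest `α`-spectral radius. -/
def spectralExtremal {r : ℕ} (α : ℝ) (F : ∀ n, Set (UniformHypergraph (Fin n) r))
    (n : ℕ) : Set (UniformHypergraph (Fin n) r) :=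
  {G | G ∈ F n ∧ G.spectralRadius α = maxSpectralRadius α F n}

end

/-!
All graphs below live on a coloured vertex set. If `φ` colours an extremal graph `G`, then the
complete graph of `φ`, which has every edge that the pattern allows, contains `G` and is colourable.
Hence it has the same spectral radius `Λ`, and every principal eigenvector of `G` is principal for
it (`principal_complete_of_extremal`). Write `link u` for `r!` times the link polynomial of `u`. As
`α > 1`, the eigenequation `link u = r * Λ * x u ^ (α - 1)` holds at all vertices, including those
of weight zero (`linkSum_of_principal`).

The link of `u` and the link of another vertex `v` recoloured like `u` agree, except for edges
containing both vertices (`sum_complete_swap`). This has three consequences.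

* *Entries are constant on colour classes* (`principal_eq_of_color_eq`): for `φ u = φ v` the links
  differ only by a nonnegative multiple of `x v - x u`, while `x u ^ (α - 1)` is increasing in
  `x u`.

* *Growth*: add a vertex to a colour class of size `m ≥ n / l`, keeping the total `α`-mass of the
  class. An edge with `k` vertices in the class gains a factor
  `(m / (m + 1)) ^ (k / α) * (m + 1) / (m + 1 - k) ≥ 1 + k / m * (1 - 1 / α - 1 / (α * m))`
  (for large `n`) by double counting (`sum_edges_clone_ge`), and summing over the edges with Euler's identity for
  the class gives the first inequality of the theorem (`spectralRadius_clone_ge`).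

* *Entries are nearly equal* (`entries_of_principal`): recolouring a vertex `v` of least weight like
  any vertex `u` cannot increase `Λ`, so that `link u` exceeds `link v` by at most the contribution
  of the edges containing both (`rpow_le_of_recolor`). That contribution has relative order `1 / n`,
  because `Λ` is at least of order `n ^ (r - r / α)`. So all `x u ^ (α - 1)` are
  `n ^ (-(α - 1) / α) * (1 + O(1 / n))`, which bounds the smallest entry; inserted into the
  eigenequation together with `Λ ≥ r! * π * (n choose r) * n ^ (-r / α)`, it bounds the degrees.

The existence of `π` is the averaging argument that `ex(n) / (n choose r)` decreases, which also
gives `ex(n) ≥ π * (n choose r)`; blow-ups of an edge of the pattern show that `π > 0`.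
-/

/-! ### The spectral radius and the eigenequation -/

namespace UniformHypergraph

section Spectral

variable {V : Type*} {r : ℕ}

instance instFinite [Finite V] : Finite (UniformHypergraph V r) :=
  Finite.of_injective (fun G => G.edges) fun _ _ h => UniformHypergraph.ext h

/-- The link polynomial of `u`: up to the factor `r!`, the partial derivative of the Lagrangian
polynomial at `x` in the direction of `u`. -/
noncomputable def linkSum [DecidableEq V] (G : UniformHypergraph V r) (x : V → ℝ) (u : V) : ℝ :=
  ∑ e ∈ G.edges with u ∈ e, ∏ i ∈ e.erase u, x i

/-- The Lagrangian polynomial is affine in each variable. -/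
theorem lagrangian_update [DecidableEq V] (G : UniformHypergraph V r) (x : V → ℝ) (u : V)
    (t : ℝ) :
    G.lagrangian (Function.update x u t) =
      G.lagrangian x + (t - x u) * (r.factorial * G.linkSum x u) := by
  have key : ∀ e : Finset V, ∏ i ∈ e, Function.update x u t i =
      ∏ i ∈ e, x i + (t - x u) * (if u ∈ e then ∏ i ∈ e.erase u, x i else 0) := by
    intro e
    split_ifs with h
    · rw [← Finset.mul_prod_erase e _ h, ← Finset.mul_prod_erase e x h,
        Finset.prod_congr rfl fun i hi => Function.update_of_ne (Finset.ne_of_mem_erase hi) _ _,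
        Function.update_self]
      ring
    · rw [mul_zero, add_zero]
      exact Finset.prod_congr rfl fun i hi =>
        Function.update_of_ne (by rintro rfl; exact h hi) _ _
  unfold lagrangian linkSum
  simp_rw [key]
  rw [Finset.sum_add_distrib, ← Finset.mul_sum, Finset.sum_filter]
  ring

theorem lagrangian_smul (G : UniformHypergraph V r) (c : ℝ) (x : V → ℝ) :
    G.lagrangian (fun i => c * x i) = c ^ r * G.lagrangian x := by
  unfold lagrangian
  rw [Finset.mul_sum, Finset.mul_sum, Finset.mul_sum]
  refine Finset.sum_congr rfl fun e he => ?_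
  rw [Finset.prod_mul_distrib, Finset.prod_const, G.uniform e he]
  ring

theorem lagrangian_mono {G H : UniformHypergraph V r} (h : G.edges ⊆ H.edges) {x : V → ℝ}
    (hx : ∀ i, 0 ≤ x i) : G.lagrangian x ≤ H.lagrangian x := by
  unfold lagrangian
  gcongr
  exact fun e _ _ => Finset.prod_nonneg fun i _ => hx i

theorem continuous_lagrangian (G : UniformHypergraph V r) : Continuous G.lagrangian := by
  unfold lagrangian
  fun_prop

theorem lagrangian_le_abs (G : UniformHypergraph V r) (x : V → ℝ) :
    G.lagrangian x ≤ G.lagrangian fun i => |x i| := by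
  unfold lagrangian
  refine mul_le_mul_of_nonneg_left (Finset.sum_le_sum fun e _ => ?_) (by positivity)
  rw [← Finset.abs_prod]
  exact le_abs_self _

/-- Euler's identity, restricted to the vertices in `s`. -/
theorem sum_mul_linkSum [DecidableEq V] (G : UniformHypergraph V r) (x : V → ℝ)
    (s : Finset V) :
    ∑ u ∈ s, x u * G.linkSum x u =
      ∑ e ∈ G.edges, ((e ∩ s).card : ℝ) * ∏ i ∈ e, x i := by
  unfold linkSum
  simp_rw [Finset.mul_sum, Finset.sum_filter]
  rw [Finset.sum_comm]
  refine Finset.sum_congr rfl fun e _ => ?_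
  have : ∀ u ∈ s, (if u ∈ e then x u * ∏ i ∈ e.erase u, x i else 0) =
      if u ∈ e then ∏ i ∈ e, x i else 0 := by
    intro u _
    split_ifs with h
    · exact Finset.mul_prod_erase e x h
    · rfl
  rw [Finset.sum_congr rfl this, ← Finset.sum_filter, Finset.sum_const, nsmul_eq_mul,
    Finset.filter_mem_eq_inter, Finset.inter_comm]

variable [Fintype V] {α : ℝ}

theorem alphaNorm_eq_one_iff (hα : 0 < α) (x : V → ℝ) :
    alphaNorm α x = 1 ↔ ∑ i, |x i| ^ α = 1 := by
  unfold alphaNorm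
  have h0 : 0 ≤ ∑ i, |x i| ^ α := Finset.sum_nonneg fun i _ => by positivity
  rw [← Real.rpow_left_inj h0 zero_le_one (one_div_pos.2 hα).ne', Real.one_rpow]

theorem abs_le_one_of_sum_eq_one (hα : 0 < α) {x : V → ℝ} (hx : ∑ i, |x i| ^ α = 1) (i : V) :
    |x i| ≤ 1 := by
  have h : |x i| ^ α ≤ 1 := hx ▸ Finset.single_le_sum
    (f := fun i => |x i| ^ α) (fun j _ => by positivity) (Finset.mem_univ i)
  by_contra! h'
  exact absurd h (not_le.2 (Real.one_lt_rpow h' hα))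

theorem isCompact_sphere (hα : 0 < α) : IsCompact {x : V → ℝ | alphaNorm α x = 1} := by
  refine Metric.isCompact_of_isClosed_isBounded ?_ ?_
  · have : Continuous fun x : V → ℝ => ∑ i, |x i| ^ α := by
      refine continuous_finsetSum _ fun i _ => ?_
      exact (continuous_abs.comp (continuous_apply i)).rpow_const fun _ => Or.inr hα.le
    simp_rw [alphaNorm_eq_one_iff hα]
    exact isClosed_eq this continuous_const
  · refine (Metric.isBounded_closedBall (x := (0 : V → ℝ)) (r := 1)).subset fun x hx => ?_
    rw [mem_closedBall_zero_iff, pi_norm_le_iff_of_nonneg zero_le_one]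
    exact abs_le_one_of_sum_eq_one hα ((alphaNorm_eq_one_iff hα x).1 hx)

theorem lagrangian_le_spectralRadius (hα : 0 < α) (G : UniformHypergraph V r) {x : V → ℝ}
    (hx : ∑ i, |x i| ^ α = 1) : G.lagrangian x ≤ G.spectralRadius α :=
  le_csSup ((isCompact_sphere hα).image G.continuous_lagrangian).bddAbove
    ⟨x, (alphaNorm_eq_one_iff hα x).2 hx, rfl⟩

/-- The homogeneous form of the definition of the spectral radius. -/
theorem lagrangian_le_mul_rpow (hα : 0 < α) (hr : r ≠ 0) (G : UniformHypergraph V r)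
    (x : V → ℝ) :
    G.lagrangian x ≤ G.spectralRadius α * (∑ i, |x i| ^ α) ^ (r / α) := by
  set N := ∑ i, |x i| ^ α with hN
  have h0 : 0 ≤ N := Finset.sum_nonneg fun i _ => by positivity
  rcases h0.eq_or_lt with h | h
  · have hx : ∀ i, x i = 0 := by
      intro i
      have := (Finset.sum_eq_zero_iff_of_nonneg
        (fun i _ => Real.rpow_nonneg (abs_nonneg (x i)) α)).1 (hN.symm.trans h.symm) i
          (Finset.mem_univ i)
      rwa [Real.rpow_eq_zero (abs_nonneg _) hα.ne', abs_eq_zero] at this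
    have hL : G.lagrangian x = 0 := by
      unfold lagrangian
      rw [Finset.sum_eq_zero, mul_zero]
      intro e he
      obtain ⟨i, hi⟩ : e.Nonempty := Finset.card_ne_zero.1 (by rw [G.uniform e he]; exact hr)
      exact Finset.prod_eq_zero hi (hx i)
    rw [hL, ← h, Real.zero_rpow (by positivity), mul_zero]
  · set c := N ^ (1 / α) with hc
    have hcpos : 0 < c := by positivity
    have hcα : c ^ α = N := by
      rw [hc, ← Real.rpow_mul h0, one_div_mul_cancel hα.ne', Real.rpow_one]
    have hcr : c ^ r = N ^ (r / α) := by
      rw [hc, ← Real.rpow_natCast, ← Real.rpow_mul h0]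
      congr 1
      ring
    have hy : ∑ i, |c⁻¹ * x i| ^ α = 1 := by
      simp_rw [abs_mul, abs_of_pos (inv_pos.2 hcpos),
        Real.mul_rpow (inv_pos.2 hcpos).le (abs_nonneg _)]
      rw [← Finset.mul_sum, ← hN, Real.inv_rpow hcpos.le, hcα, inv_mul_cancel₀ h.ne']
    have h1 := G.lagrangian_le_spectralRadius hα hy
    rw [lagrangian_smul, inv_pow, inv_mul_le_iff₀ (by positivity), hcr] at h1
    linarith

theorem principalEigenvectors_nonempty [Nonempty V] (hα : 0 < α) (G : UniformHypergraph V r) :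
    (G.principalEigenvectors α).Nonempty := by
  classical
  have hne : {x : V → ℝ | alphaNorm α x = 1}.Nonempty := by
    obtain ⟨v⟩ := ‹Nonempty V›
    refine ⟨Pi.single v 1, (alphaNorm_eq_one_iff hα _).2 ?_⟩
    rw [Finset.sum_eq_single v]
    · simp
    · intro b _ hb
      simp [Pi.single_eq_of_ne hb, Real.zero_rpow hα.ne']
    · simp
  obtain ⟨x, hx, hmax⟩ := (isCompact_sphere hα).exists_isMaxOn hne
    G.continuous_lagrangian.continuousOn
  have hs : G.spectralRadius α ≤ G.lagrangian x :=
    csSup_le (hne.image _) (by rintro _ ⟨y, hy, rfl⟩; exact hmax hy)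
  have hx' : ∑ i, |(|x i|)| ^ α = 1 := by
    simpa using (alphaNorm_eq_one_iff hα x).1 hx
  exact ⟨fun i => |x i|, fun i => abs_nonneg _, (alphaNorm_eq_one_iff hα _).2 hx',
    le_antisymm (G.lagrangian_le_spectralRadius hα hx') (hs.trans (G.lagrangian_le_abs x))⟩

theorem sum_rpow_of_principal (hα : 0 < α) {G : UniformHypergraph V r} {x : V → ℝ}
    (hx : x ∈ G.principalEigenvectors α) : ∑ i, x i ^ α = 1 := by
  rw [← (alphaNorm_eq_one_iff hα x).1 hx.2.1]
  exact Finset.sum_congr rfl fun i _ => by rw [abs_of_nonneg (hx.1 i)]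

/-- The eigenequation. As `α > 1`, the function `t ↦ |t| ^ α` is differentiable at `0` too, so
that the Lagrange condition holds with equality also at the zero entries of `x`. -/
theorem linkSum_of_principal [DecidableEq V] (hα : 1 < α) (hr : r ≠ 0)
    {G : UniformHypergraph V r} {x : V → ℝ} (hx : x ∈ G.principalEigenvectors α) (u : V) :
    r.factorial * G.linkSum x u = r * G.spectralRadius α * x u ^ (α - 1) := by
  have hα0 : 0 < α := by linarith
  have hsum := (alphaNorm_eq_one_iff hα0 x).1 hx.2.1
  set L := (r.factorial : ℝ) * G.linkSum x u
  set Λ := G.spectralRadius α with hΛ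
  set g : ℝ → ℝ := fun t => Λ * (1 - |x u| ^ α + |t| ^ α) ^ (r / α) - (t - x u) * L with hg
  have hmin : IsLocalMin g (x u) := by
    refine Eventually.of_forall fun t => ?_
    have h1 := G.lagrangian_le_mul_rpow hα0 hr (Function.update x u t)
    have h2 : ∑ i, |Function.update x u t i| ^ α = 1 - |x u| ^ α + |t| ^ α := by
      rw [← Finset.add_sum_erase _ _ (Finset.mem_univ u), Function.update_self, ← hsum,
        ← Finset.add_sum_erase _ _ (Finset.mem_univ u),
        Finset.sum_congr rfl fun i hi => by
          rw [Function.update_of_ne (Finset.ne_of_mem_erase hi)]]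
      ring
    rw [lagrangian_update, h2, hx.2.2] at h1
    simp only [hg, sub_add_cancel, Real.one_rpow, sub_self, zero_mul, mul_one]
    linarith
  have hd : HasDerivAt g (Λ * ((α * |x u| ^ (α - 2) * x u) * (r / α) *
      (1 - |x u| ^ α + |x u| ^ α) ^ (r / α - 1)) - 1 * L) (x u) := by
    have h1 := (hasDerivAt_abs_rpow (x u) hα).const_add (1 - |x u| ^ α)
    have h2 := h1.rpow_const (p := r / α) (Or.inl (by simp))
    exact (h2.const_mul Λ).sub (((hasDerivAt_id (x u)).sub_const (x u)).mul_const L)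
  have h0 := hmin.hasDerivAt_eq_zero hd
  rw [sub_add_cancel, Real.one_rpow, abs_of_nonneg (hx.1 u)] at h0
  have hp : x u ^ (α - 2) * x u = x u ^ (α - 1) := by
    rcases (hx.1 u).eq_or_lt with h | h
    · rw [← h, mul_zero, Real.zero_rpow (by linarith)]
    · rw [← Real.rpow_add_one h.ne']
      congr 1
      ring
  have : L = Λ * (α * (x u ^ (α - 2) * x u) * (r / α)) := by linarith
  rw [this, hp]
  field_simp

end Spectral

end UniformHypergraph

/-! ### Complete graphs of a colouring, and recolouring -/

namespace UniformHypergraph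

section Complete

variable {V : Type*} {r : ℕ}

/-- The link of `u` splits into the edges that avoid `v` and, with `x v` as a common factor, the
edges that contain `v`. -/
theorem linkSum_eq_sum_add_mul [DecidableEq V] (G : UniformHypergraph V r) (x : V → ℝ)
    {u v : V} (huv : u ≠ v) :
    G.linkSum x u = ∑ e ∈ G.edges with u ∈ e ∧ v ∉ e, ∏ i ∈ e.erase u, x i +
      x v * ∑ e ∈ G.edges with u ∈ e ∧ v ∈ e, ∏ i ∈ (e.erase u).erase v, x i := by
  unfold linkSum
  rw [← Finset.sum_filter_not_add_sum_filter _ (fun e => v ∈ e), Finset.filter_filter,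
    Finset.filter_filter, Finset.mul_sum]
  congr 1
  refine Finset.sum_congr rfl fun e he => ?_
  rw [Finset.mem_filter] at he
  exact (Finset.mul_prod_erase _ _ (Finset.mem_erase.2 ⟨huv.symm, he.2.2⟩)).symm

/-- A crude form, without the factor `k!`, of the bound on an elementary symmetric polynomial by a
power of the sum. -/
theorem sum_powersetCard_prod_le {x : V → ℝ} (hx : ∀ i, 0 ≤ x i) (s : Finset V) (k : ℕ) :
    ∑ e ∈ s.powersetCard k, ∏ i ∈ e, x i ≤ (∑ i ∈ s, x i) ^ k := by
  classical
  induction s using Finset.induction_on generalizing k with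
  | empty =>
    cases k with
    | zero => simp
    | succ k => rw [Finset.powersetCard_eq_empty.2 (by simp)]; simp
  | insert a s ha ih =>
    cases k with
    | zero => simp
    | succ k =>
      have hS : 0 ≤ ∑ i ∈ s, x i := Finset.sum_nonneg fun i _ => hx i
      have hinj : Set.InjOn (insert a) (s.powersetCard k : Set (Finset V)) := by
        intro e he f hf h
        rw [Finset.mem_coe, Finset.mem_powersetCard] at he hf
        rw [← Finset.erase_insert (fun h => ha (he.1 h)), h,
          Finset.erase_insert (fun h => ha (hf.1 h))]
      have hdisj : Disjoint (s.powersetCard (k + 1)) ((s.powersetCard k).image (insert a)) := by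
        rw [Finset.disjoint_left]
        intro e he he'
        obtain ⟨f, -, rfl⟩ := Finset.mem_image.1 he'
        exact ha ((Finset.mem_powersetCard.1 he).1 (Finset.mem_insert_self a f))
      rw [Finset.powersetCard_succ_insert ha, Finset.sum_union hdisj, Finset.sum_image hinj,
        Finset.sum_insert ha]
      have h1 : ∑ e ∈ s.powersetCard k, ∏ i ∈ insert a e, x i =
          x a * ∑ e ∈ s.powersetCard k, ∏ i ∈ e, x i := by
        rw [Finset.mul_sum]
        refine Finset.sum_congr rfl fun e he => Finset.prod_insert fun h => ?_
        exact ha ((Finset.mem_powersetCard.1 he).1 h)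
      rw [h1]
      calc _ ≤ (∑ i ∈ s, x i) ^ (k + 1) + x a * (∑ i ∈ s, x i) ^ k :=
            add_le_add (ih _) (mul_le_mul_of_nonneg_left (ih _) (hx a))
        _ = (x a + ∑ i ∈ s, x i) * (∑ i ∈ s, x i) ^ k := by ring
        _ ≤ (x a + ∑ i ∈ s, x i) * (x a + ∑ i ∈ s, x i) ^ k := by
            have := hx a
            gcongr
            linarith
        _ = _ := by ring

theorem sum_pair_link_le [Fintype V] [DecidableEq V] (G : UniformHypergraph V r) {x : V → ℝ}
    (hx : ∀ i, 0 ≤ x i) {u v : V} (huv : u ≠ v) :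
    ∑ e ∈ G.edges with u ∈ e ∧ v ∈ e, ∏ i ∈ (e.erase u).erase v, x i ≤
      (∑ i, x i) ^ (r - 2) := by
  refine le_trans ?_ (sum_powersetCard_prod_le hx Finset.univ (r - 2))
  have hinj : Set.InjOn (fun e : Finset V => (e.erase u).erase v)
      ({e ∈ G.edges | u ∈ e ∧ v ∈ e} : Finset (Finset V)) := by
    intro e he f hf h
    rw [Finset.mem_coe, Finset.mem_filter] at he hf
    rw [← Finset.insert_erase he.2.1, ← Finset.insert_erase hf.2.1,
      ← Finset.insert_erase (Finset.mem_erase.2 ⟨huv.symm, he.2.2⟩),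
      ← Finset.insert_erase (Finset.mem_erase.2 ⟨huv.symm, hf.2.2⟩)]
    exact congrArg (fun s => insert u (insert v s)) h
  rw [← Finset.sum_image (f := fun e => ∏ i ∈ e, x i) hinj]
  refine Finset.sum_le_sum_of_subset_of_nonneg ?_ fun e _ _ =>
    Finset.prod_nonneg fun i _ => hx i
  intro f hf
  obtain ⟨e, he, rfl⟩ := Finset.mem_image.1 hf
  rw [Finset.mem_filter] at he
  rw [Finset.mem_powersetCard]
  refine ⟨Finset.subset_univ _, ?_⟩
  rw [Finset.card_erase_of_mem (Finset.mem_erase.2 ⟨huv.symm, he.2.2⟩),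
    Finset.card_erase_of_mem he.2.1, G.uniform e he.1]
  omega

theorem map_swap_erase [DecidableEq V] {e : Finset V} {u v : V} (hv : v ∉ e) :
    (e.map (Equiv.swap u v).toEmbedding).erase v = e.erase u := by
  ext w
  rw [Finset.mem_erase, Finset.mem_erase, Finset.mem_map_equiv, Equiv.symm_swap]
  by_cases hwv : w = v
  · subst hwv; simp [hv]
  · by_cases hwu : w = u
    · subst hwu; simp [hv]
    · rw [Equiv.swap_apply_of_ne_of_ne hwu hwv]
      simp [hwv, hwu]

variable [Fintype V]

open Classical in
/-- The complete `r`-graph with respect to the colouring `φ`: its edges are all sets of vertices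
whose multiset of colours belongs to the pattern. -/
noncomputable def complete (P : Pattern r) (φ : V → Fin P.l) : UniformHypergraph V r where
  edges := {e | ∃ s ∈ P.E, (s : Multiset (Fin P.l)) = e.val.map φ}
  uniform := by
    intro e he
    obtain ⟨s, -, hs⟩ := (Finset.mem_filter.1 he).2
    have := congrArg Multiset.card hs
    rw [Multiset.card_map, Finset.card_val] at this
    rw [← this]
    exact s.2

variable {P : Pattern r}

theorem mem_complete_edges {φ : V → Fin P.l} {e : Finset V} :
    e ∈ (complete P φ).edges ↔ ∃ s ∈ P.E, (s : Multiset (Fin P.l)) = e.val.map φ := by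
  simp [complete]

theorem IsHom.edges_subset {G : UniformHypergraph V r} {φ : V → Fin P.l} (h : G.IsHom P φ) :
    G.edges ⊆ (complete P φ).edges :=
  fun e he => mem_complete_edges.2 (h e he)

theorem complete_isColorable (φ : V → Fin P.l) : (complete P φ).IsColorable P :=
  ⟨φ, fun _ he => mem_complete_edges.1 he⟩

/-- Membership in a complete graph is transported along a map that preserves colours. -/
theorem map_mem_complete_edges {W : Type*} [Fintype W] (f : V ↪ W) {φ : V → Fin P.l}
    {ψ : W → Fin P.l} {e : Finset V} (h : ∀ v ∈ e, ψ (f v) = φ v) :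
    e.map f ∈ (complete P ψ).edges ↔ e ∈ (complete P φ).edges := by
  rw [mem_complete_edges, mem_complete_edges, Finset.map_val, Multiset.map_map,
    Multiset.map_congr (f := ψ ∘ f) (g := φ) rfl h]

/-- If `v` receives the colour of `u`, then swapping `u` and `v` exchanges the edges through `v`
that avoid `u` with the former edges through `u` that avoid `v`. -/
theorem sum_complete_swap [DecidableEq V] {φ ψ : V → Fin P.l} {u v : V}
    (h : ∀ w, w ≠ v → ψ w = φ w) (hv : ψ v = φ u) (F : Finset V → ℝ) :
    ∑ e ∈ (complete P ψ).edges with v ∈ e ∧ u ∉ e, F e =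
      ∑ e ∈ (complete P φ).edges with u ∈ e ∧ v ∉ e,
        F (e.map (Equiv.swap u v).toEmbedding) := by
  have hinv : ∀ e : Finset V,
      (e.map (Equiv.swap u v).toEmbedding).map (Equiv.swap u v).toEmbedding = e := by
    intro e
    rw [Finset.map_map]
    convert Finset.map_refl
    ext w
    simp
  have hmem : ∀ (e : Finset V) (w : V), w ∈ e.map (Equiv.swap u v).toEmbedding ↔
      Equiv.swap u v w ∈ e := by
    intro e w
    rw [Finset.mem_map_equiv, Equiv.symm_swap]
  symm
  refine Finset.sum_nbij' (fun e => e.map (Equiv.swap u v).toEmbedding)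
    (fun e => e.map (Equiv.swap u v).toEmbedding) ?_ ?_ (fun e _ => hinv e) (fun e _ => hinv e)
    (fun e _ => rfl)
  · intro e he
    rw [Finset.mem_filter] at he ⊢
    rw [hmem, hmem, Equiv.swap_apply_right, Equiv.swap_apply_left]
    refine ⟨(map_mem_complete_edges _ fun w hw => ?_).2 he.1, he.2⟩
    have hwv : w ≠ v := by rintro rfl; exact he.2.2 hw
    by_cases hwu : w = u
    · subst hwu; simp [hv]
    · simp [Equiv.swap_apply_of_ne_of_ne hwu hwv, h w hwv]
  · intro e he
    rw [Finset.mem_filter] at he ⊢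
    rw [hmem, hmem, Equiv.swap_apply_right, Equiv.swap_apply_left]
    refine ⟨(map_mem_complete_edges _ fun w hw => ?_).2 he.1, he.2⟩
    have hwu : w ≠ u := by rintro rfl; exact he.2.2 hw
    by_cases hwv : w = v
    · subst hwv; simp [hv]
    · simp [Equiv.swap_apply_of_ne_of_ne hwu hwv, h w hwv]

/-- If `v` receives the colour of `u`, then away from `u` its new link is the old link of `u`. -/
theorem sum_link_recolor [DecidableEq V] {φ ψ : V → Fin P.l} {u v : V}
    (h : ∀ w, w ≠ v → ψ w = φ w) (hv : ψ v = φ u) (x : V → ℝ) :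
    ∑ e ∈ (complete P ψ).edges with v ∈ e ∧ u ∉ e, ∏ i ∈ e.erase v, x i =
      ∑ e ∈ (complete P φ).edges with u ∈ e ∧ v ∉ e, ∏ i ∈ e.erase u, x i := by
  rw [sum_complete_swap h hv]
  refine Finset.sum_congr rfl fun e he => ?_
  rw [map_swap_erase (Finset.mem_filter.1 he).2.2]

theorem lagrangian_update_zero_recolor [DecidableEq V] {φ ψ : V → Fin P.l} {v : V}
    (h : ∀ w, w ≠ v → ψ w = φ w) (x : V → ℝ) :
    (complete P ψ).lagrangian (Function.update x v 0) =
      (complete P φ).lagrangian (Function.update x v 0) := by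
  have key : ∀ χ : V → Fin P.l, (complete P χ).lagrangian (Function.update x v 0) =
      r.factorial * ∑ e ∈ (complete P χ).edges with v ∉ e,
        ∏ i ∈ e, Function.update x v 0 i := by
    intro χ
    unfold lagrangian
    congr 1
    refine (Finset.sum_subset (Finset.filter_subset _ _) fun e he he' => ?_).symm
    rw [Finset.mem_filter, not_and, not_not] at he'
    exact Finset.prod_eq_zero (he' he) (by simp)
  rw [key, key]
  congr 2
  ext e
  simp only [Finset.mem_filter, and_congr_left_iff]
  intro hve
  have := map_mem_complete_edges (P := P) (Function.Embedding.refl V) (φ := φ) (ψ := ψ) (e := e)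
    fun w hw => h w (by rintro rfl; exact hve hw)
  rwa [Finset.map_refl] at this

variable {α : ℝ}

/-- Recolouring `v` with the colour of `u` must not increase the spectral radius. When `x v = 0`
the vector `x` is principal for the recoloured graph as well, and the eigenequation of that graph
at `v` takes the place of the comparison of links. -/
theorem rpow_le_of_recolor [DecidableEq V] (hα : 1 < α) (hr : r ≠ 0) {φ ψ : V → Fin P.l}
    {x : V → ℝ} (hx : x ∈ (complete P φ).principalEigenvectors α) {u v : V} (huv : u ≠ v)
    (h : ∀ w, w ≠ v → ψ w = φ w) (hv : ψ v = φ u)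
    (hψ : (complete P ψ).spectralRadius α ≤ (complete P φ).spectralRadius α) :
    r * (complete P φ).spectralRadius α * x u ^ (α - 1) ≤
      r * (complete P φ).spectralRadius α * x v ^ (α - 1) +
        r.factorial * (x v * ∑ e ∈ (complete P φ).edges with u ∈ e ∧ v ∈ e,
          ∏ i ∈ (e.erase u).erase v, x i) := by
  have hα0 : 0 < α := by linarith
  have hfac : (0 : ℝ) < r.factorial := by positivity
  have hu := linkSum_of_principal hα hr hx u
  have hv' := linkSum_of_principal hα hr hx v
  rw [linkSum_eq_sum_add_mul _ _ huv, mul_add] at hu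
  have hlink : r.factorial * ∑ e ∈ (complete P φ).edges with u ∈ e ∧ v ∉ e,
      ∏ i ∈ e.erase u, x i ≤ r.factorial * (complete P ψ).linkSum x v := by
    rw [← sum_link_recolor h hv, linkSum_eq_sum_add_mul (complete P ψ) x huv.symm]
    refine mul_le_mul_of_nonneg_left (le_add_of_nonneg_right ?_) hfac.le
    exact mul_nonneg (hx.1 u) (Finset.sum_nonneg fun e _ => Finset.prod_nonneg fun i _ => hx.1 i)
  have e1 := lagrangian_update (complete P φ) x v 0
  have e2 := lagrangian_update (complete P ψ) x v 0
  rw [lagrangian_update_zero_recolor h, e1] at e2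
  have hle : (complete P ψ).lagrangian x ≤ (complete P ψ).spectralRadius α :=
    lagrangian_le_spectralRadius hα0 _ ((alphaNorm_eq_one_iff hα0 x).1 hx.2.1)
  have hφ := hx.2.2
  suffices hs : r.factorial * (complete P ψ).linkSum x v ≤
      r * (complete P φ).spectralRadius α * x v ^ (α - 1) by linarith
  rcases (hx.1 v).eq_or_lt with h0 | hpos
  · have hψx : x ∈ (complete P ψ).principalEigenvectors α := by
      refine ⟨hx.1, hx.2.1, le_antisymm hle ?_⟩
      rw [← h0] at e2
      linarith
    rw [linkSum_of_principal hα hr hψx v, ← h0, Real.zero_rpow (by linarith), mul_zero, mul_zero]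
  · rw [← hv']
    have : x v * (r.factorial * (complete P ψ).linkSum x v) ≤
        x v * (r.factorial * (complete P φ).linkSum x v) := by linarith
    exact le_of_mul_le_mul_left this hpos

/-- A principal eigenvector of a complete graph is constant on each colour class: the links of
`u` and `v` differ only in the factor `x v` against `x u`. -/
theorem principal_eq_of_color_eq (hα : 1 < α) (hr : r ≠ 0) {φ : V → Fin P.l}
    {x : V → ℝ} (hx : x ∈ (complete P φ).principalEigenvectors α)
    (hpos : 0 < (complete P φ).spectralRadius α) {u v : V} (huv : φ u = φ v) : x u = x v := by
  classical
  by_contra hne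
  wlog hlt : x v < x u generalizing u v
  · exact this huv.symm (fun h => hne h.symm) (lt_of_le_of_ne (not_lt.1 hlt) hne)
  have hne' : u ≠ v := by rintro rfl; exact hne rfl
  have hu := linkSum_of_principal hα hr hx u
  have hv := linkSum_of_principal hα hr hx v
  rw [linkSum_eq_sum_add_mul _ _ hne'] at hu
  rw [linkSum_eq_sum_add_mul _ _ hne'.symm,
    sum_link_recolor (φ := φ) (u := u) (v := v) (fun _ _ => rfl) huv.symm] at hv
  have hpair : ∑ e ∈ (complete P φ).edges with v ∈ e ∧ u ∈ e, ∏ i ∈ (e.erase v).erase u, x i =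
      ∑ e ∈ (complete P φ).edges with u ∈ e ∧ v ∈ e, ∏ i ∈ (e.erase u).erase v, x i := by
    simp_rw [and_comm (a := v ∈ _), Finset.erase_right_comm (a := v)]
  rw [hpair] at hv
  set D := ∑ e ∈ (complete P φ).edges with u ∈ e ∧ v ∈ e, ∏ i ∈ (e.erase u).erase v, x i
  have hD : 0 ≤ D := Finset.sum_nonneg fun e _ => Finset.prod_nonneg fun i _ => hx.1 i
  have h1 : x v ^ (α - 1) < x u ^ (α - 1) := Real.rpow_lt_rpow (hx.1 v) hlt (by linarith)
  have h2 : r * (complete P φ).spectralRadius α * x v ^ (α - 1) <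
      r * (complete P φ).spectralRadius α * x u ^ (α - 1) := by
    have : (0 : ℝ) < r := by exact_mod_cast Nat.pos_of_ne_zero hr
    gcongr
  have h3 : r.factorial * (x v * D) ≤ r.factorial * (x u * D) := by gcongr
  rw [mul_add] at hu hv
  linarith

end Complete

end UniformHypergraph

/-! ### The edge density -/

section Density

variable {r : ℕ} {P : Pattern r} {n : ℕ}

theorem complete_mem_Col (φ : Fin n → Fin P.l) : UniformHypergraph.complete P φ ∈ Col P n :=
  UniformHypergraph.complete_isColorable φ

theorem card_edges_le_exNumber {G : UniformHypergraph (Fin n) r} (hG : G ∈ Col P n) :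
    G.edges.card ≤ exNumber (Col P) n :=
  le_csSup (Set.toFinite _).bddAbove ⟨G, hG, rfl⟩

theorem exists_card_edges_eq_exNumber (P : Pattern r) (n : ℕ) :
    ∃ G ∈ Col P n, G.edges.card = exNumber (Col P) n := by
  have hne : (Col P n).Nonempty := ⟨_, complete_mem_Col fun _ => ⟨0, P.l_pos⟩⟩
  exact Nat.sSup_mem (hne.image fun G : UniformHypergraph (Fin n) r => G.edges.card)
    (Set.toFinite _).bddAbove

theorem spectralRadius_le_maxSpectralRadius (α : ℝ) {G : UniformHypergraph (Fin n) r}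
    (hG : G ∈ Col P n) : G.spectralRadius α ≤ maxSpectralRadius α (Col P) n :=
  le_csSup (Set.toFinite _).bddAbove ⟨G, hG, rfl⟩

namespace UniformHypergraph

/-- The graph obtained by deleting the vertex `w`. -/
def deleteVertex (G : UniformHypergraph (Fin (n + 1)) r) (w : Fin (n + 1)) :
    UniformHypergraph (Fin n) r where
  edges := {e | e.map w.succAboveEmb ∈ G.edges}
  uniform := by
    intro e he
    rw [← Finset.card_map w.succAboveEmb]
    exact G.uniform _ (Finset.mem_filter.1 he).2

theorem deleteVertex_mem_Col {G : UniformHypergraph (Fin (n + 1)) r} (hG : G ∈ Col P (n + 1))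
    (w : Fin (n + 1)) : G.deleteVertex w ∈ Col P n := by
  obtain ⟨φ, hφ⟩ := hG
  refine ⟨φ ∘ w.succAbove, fun e he => ?_⟩
  obtain ⟨s, hs, hse⟩ := hφ _ (Finset.mem_filter.1 he).2
  refine ⟨s, hs, hse.trans ?_⟩
  rw [Finset.map_val, Multiset.map_map]
  rfl

theorem card_edges_deleteVertex (G : UniformHypergraph (Fin (n + 1)) r) (w : Fin (n + 1)) :
    (G.deleteVertex w).edges.card = {e ∈ G.edges | w ∉ e}.card := by
  refine Finset.card_bij (fun e _ => e.map w.succAboveEmb) ?_ ?_ ?_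
  · intro e he
    refine Finset.mem_filter.2 ⟨(Finset.mem_filter.1 he).2, fun h => ?_⟩
    obtain ⟨v, -, hv⟩ := Finset.mem_map.1 h
    exact Fin.succAbove_ne w v hv
  · intro e _ f _ h
    exact Finset.map_injective _ h
  · intro e he
    obtain ⟨he, hw⟩ := Finset.mem_filter.1 he
    obtain ⟨f, hf⟩ : ∃ f : Finset (Fin n), f.map w.succAboveEmb = e := by
      refine ⟨Finset.univ.filter fun v => w.succAbove v ∈ e, ?_⟩
      ext v
      simp only [Finset.mem_map, Finset.mem_filter, Finset.mem_univ, true_and]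
      constructor
      · rintro ⟨a, ha, rfl⟩
        exact ha
      · intro hv
        obtain ⟨a, rfl⟩ := Fin.exists_succAbove_eq (x := v) (y := w) (by rintro rfl; exact hw hv)
        exact ⟨a, hv, rfl⟩
    exact ⟨f, Finset.mem_filter.2 ⟨Finset.mem_univ _, hf ▸ he⟩, hf⟩

end UniformHypergraph

/-- Averaging over the deletions of one vertex. -/
theorem exNumber_succ_mul_le (P : Pattern r) (n : ℕ) :
    exNumber (Col P) (n + 1) * (n + 1 - r) ≤ (n + 1) * exNumber (Col P) n := by
  obtain ⟨G, hG, hGe⟩ := exists_card_edges_eq_exNumber P (n + 1)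
  have h1 : ∑ w, (G.deleteVertex w).edges.card ≤ (n + 1) * exNumber (Col P) n := by
    refine (Finset.sum_le_card_nsmul _ _ (exNumber (Col P) n) fun w _ =>
      card_edges_le_exNumber (UniformHypergraph.deleteVertex_mem_Col hG w)).trans ?_
    simp
  refine le_trans (le_of_eq ?_) h1
  simp_rw [UniformHypergraph.card_edges_deleteVertex, Finset.card_filter]
  rw [Finset.sum_comm, ← hGe]
  have : ∀ e ∈ G.edges, ∑ w, (if w ∉ e then 1 else 0) = n + 1 - r := by
    intro e he
    rw [← Finset.card_filter, Finset.filter_not, Finset.filter_mem_eq_inter, Finset.univ_inter,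
      Finset.card_sdiff_of_subset (Finset.subset_univ _), G.uniform e he, Finset.card_univ,
      Fintype.card_fin]
  rw [Finset.sum_congr rfl this, Finset.sum_const, smul_eq_mul]

theorem antitone_exNumber_div_choose (P : Pattern r) :
    Antitone fun n : ℕ => (exNumber (Col P) (n + r) : ℝ) / ((n + r).choose r : ℝ) := by
  refine antitone_nat_of_succ_le fun n => ?_
  have h1 := exNumber_succ_mul_le P (n + r)
  have h2 := Nat.choose_mul_succ_eq (n + r) r
  have e : n + r + 1 - r = n + 1 := by omega
  rw [e] at h1 h2
  rw [show n + 1 + r = n + r + 1 by ring]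
  have hc1 : (0 : ℝ) < ((n + r).choose r : ℝ) := by
    exact_mod_cast Nat.choose_pos (Nat.le_add_left r n)
  have hc2 : (0 : ℝ) < ((n + r + 1).choose r : ℝ) := by
    exact_mod_cast Nat.choose_pos (by omega)
  rw [div_le_div_iff₀ hc2 hc1]
  have h1' : (exNumber (Col P) (n + r + 1) : ℝ) * (n + 1) ≤
      (n + r + 1) * exNumber (Col P) (n + r) := by exact_mod_cast h1
  have h2' : ((n + r).choose r : ℝ) * (n + r + 1) = ((n + r + 1).choose r : ℝ) * (n + 1) := by
    exact_mod_cast h2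
  have hpos : (0 : ℝ) < (n : ℝ) + 1 := by positivity
  refine le_of_mul_le_mul_right (a := (n : ℝ) + 1) ?_ hpos
  calc _ = (exNumber (Col P) (n + r + 1) * ((n : ℝ) + 1)) * ((n + r).choose r : ℝ) := by ring
    _ ≤ ((n + r + 1) * exNumber (Col P) (n + r)) * ((n + r).choose r : ℝ) := by gcongr
    _ = exNumber (Col P) (n + r) * (((n + r).choose r : ℝ) * (n + r + 1)) := by ring
    _ = _ := by rw [h2']; ring

theorem tendsto_edgeDensity (P : Pattern r) :
    Tendsto (fun n : ℕ => (exNumber (Col P) n : ℝ) / (n.choose r : ℝ)) atTop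
      (𝓝 (edgeDensity (Col P))) := by
  have h := tendsto_atTop_ciInf (antitone_exNumber_div_choose P)
    ⟨0, by rintro _ ⟨n, rfl⟩; positivity⟩
  exact tendsto_nhds_limUnder
    ⟨_, (tendsto_add_atTop_iff_nat
      (f := fun n : ℕ => (exNumber (Col P) n : ℝ) / (n.choose r : ℝ)) r).1 h⟩

theorem edgeDensity_mul_choose_le (P : Pattern r) (hn : r ≤ n) :
    edgeDensity (Col P) * n.choose r ≤ exNumber (Col P) n := by
  have h := (antitone_exNumber_div_choose P).le_of_tendsto
    ((tendsto_add_atTop_iff_nat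
      (f := fun n : ℕ => (exNumber (Col P) n : ℝ) / (n.choose r : ℝ)) r).2
      (tendsto_edgeDensity P)) (n - r)
  simp only [Nat.sub_add_cancel hn] at h
  rwa [le_div_iff₀ (by exact_mod_cast Nat.choose_pos hn)] at h

/-- The balanced blow-up of a single edge `{c 0, …, c (r - 1)}` of the pattern, with `t` vertices
for each index. -/
theorem pow_le_exNumber (hP : P.E.Nonempty) (t : ℕ) : t ^ r ≤ exNumber (Col P) (r * t) := by
  obtain ⟨s, hs⟩ := hP
  obtain ⟨c, hc⟩ : ∃ c : Fin r → Fin P.l, Finset.univ.val.map c = (s : Multiset (Fin P.l)) := by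
    obtain ⟨L, hL⟩ := Quot.exists_rep (s : Multiset (Fin P.l))
    have hlen : L.length = r :=
      (Multiset.coe_card L).symm.trans ((congrArg Multiset.card hL).trans s.2)
    refine ⟨fun i => L.get (i.cast hlen.symm), ?_⟩
    rw [Fin.univ_val_map, ← hL]
    exact congrArg _ ((List.ofFn_congr hlen.symm _).trans (List.ofFn_get L))
  let φ : Fin (r * t) → Fin P.l := fun v => c (finProdFinEquiv.symm v).1
  have hinj : ∀ q : Fin r → Fin t, Function.Injective fun j => finProdFinEquiv (j, q j) := by
    intro q i j h
    exact congrArg Prod.fst (finProdFinEquiv.injective h)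
  let edge : (Fin r → Fin t) → Finset (Fin (r * t)) := fun q =>
    Finset.univ.map ⟨fun j => finProdFinEquiv (j, q j), hinj q⟩
  have hedge : ∀ q, edge q ∈ (UniformHypergraph.complete P φ).edges := by
    intro q
    refine UniformHypergraph.mem_complete_edges.2 ⟨s, hs, ?_⟩
    rw [Finset.map_val, Multiset.map_map, ← hc]
    refine Multiset.map_congr rfl fun j _ => ?_
    exact (congrArg (fun p => c p.1) (finProdFinEquiv.symm_apply_apply (j, q j))).symm
  have hedge_inj : Function.Injective edge := by
    intro q q' h
    funext j
    have hj : finProdFinEquiv (j, q j) ∈ edge q' := by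
      rw [← h]
      exact Finset.mem_map.2 ⟨j, Finset.mem_univ _, rfl⟩
    obtain ⟨i, -, hi⟩ := Finset.mem_map.1 hj
    have := finProdFinEquiv.injective hi
    rw [Prod.mk.injEq] at this
    rw [← this.2, this.1]
  calc t ^ r = (Finset.univ : Finset (Fin r → Fin t)).card := by simp
    _ = (Finset.univ.image edge).card := (Finset.card_image_of_injective _ hedge_inj).symm
    _ ≤ (UniformHypergraph.complete P φ).edges.card := Finset.card_le_card fun e he => by
        obtain ⟨q, -, rfl⟩ := Finset.mem_image.1 he
        exact hedge q
    _ ≤ _ := card_edges_le_exNumber (complete_mem_Col φ)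

/-- Along the multiples of `r`, balanced blow-ups give density at least `r! / r ^ r`. -/
theorem edgeDensity_pos (hr : r ≠ 0) (hP : P.E.Nonempty) : 0 < edgeDensity (Col P) := by
  have hr' : 0 < r := Nat.pos_of_ne_zero hr
  refine lt_of_lt_of_le (b := (r.factorial : ℝ) / (r : ℝ) ^ r) (by positivity) ?_
  have htop : Tendsto (fun t : ℕ => r * t) atTop atTop :=
    tendsto_atTop_mono (fun t => Nat.le_mul_of_pos_left t hr') tendsto_id
  refine ge_of_tendsto ((tendsto_edgeDensity P).comp htop) ?_
  filter_upwards [eventually_ge_atTop 1] with t ht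
  have hchoose : ((r * t).choose r : ℝ) ≤ ((r * t : ℕ) : ℝ) ^ r / r.factorial :=
    Nat.choose_le_pow_div r (r * t)
  have hcpos : (0 : ℝ) < ((r * t).choose r : ℝ) := by
    exact_mod_cast Nat.choose_pos (Nat.le_mul_of_pos_right r ht)
  have hex : (t : ℝ) ^ r ≤ exNumber (Col P) (r * t) := by exact_mod_cast pow_le_exNumber hP t
  rw [Function.comp_apply, le_div_iff₀ hcpos]
  calc _ ≤ (r.factorial : ℝ) / (r : ℝ) ^ r * (((r * t : ℕ) : ℝ) ^ r / r.factorial) := by gcongr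
    _ = (t : ℝ) ^ r := by push_cast; rw [mul_pow]; field_simp
    _ ≤ _ := hex

/-- The constant vector on a graph with the most edges bounds the spectral radius from below. -/
theorem le_maxSpectralRadius (P : Pattern r) {α : ℝ} (hα : 0 < α) (hn : r ≤ n) (hn0 : 0 < n) :
    r.factorial * (edgeDensity (Col P) * n.choose r) * ((n : ℝ) ^ (-(1 / α))) ^ r ≤
      maxSpectralRadius α (Col P) n := by
  obtain ⟨G, hG, hGe⟩ := exists_card_edges_eq_exNumber P n
  refine le_trans ?_ (spectralRadius_le_maxSpectralRadius α hG)
  have hn' : (0 : ℝ) < n := by exact_mod_cast hn0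
  have hx : ∑ _i : Fin n, |(n : ℝ) ^ (-(1 / α))| ^ α = 1 := by
    rw [abs_of_pos (by positivity), ← Real.rpow_mul hn'.le, neg_mul, one_div_mul_cancel hα.ne',
      Real.rpow_neg_one, Finset.sum_const, Finset.card_univ, Fintype.card_fin, nsmul_eq_mul,
      mul_inv_cancel₀ hn'.ne']
  refine le_trans ?_ (G.lagrangian_le_spectralRadius hα hx)
  unfold UniformHypergraph.lagrangian
  rw [Finset.sum_congr rfl fun e he => by rw [Finset.prod_const, G.uniform e he],
    Finset.sum_const, nsmul_eq_mul, hGe, mul_assoc]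
  gcongr
  exact edgeDensity_mul_choose_le P hn

end Density

/-! ### Adding a vertex to a colour class -/

/-- Bernoulli's inequality for negative exponents. -/
theorem one_sub_mul_le_rpow_neg {t p : ℝ} (ht : 0 ≤ t) (hp : 0 ≤ p) :
    1 - p * t ≤ (1 + t) ^ (-p) := by
  have h1 : (0 : ℝ) < 1 + t := by linarith
  have h2 := Real.log_le_sub_one_of_pos h1
  have h3 := Real.add_one_le_exp (Real.log (1 + t) * -p)
  rw [Real.rpow_def_of_pos h1]
  nlinarith

/-- The gain from enlarging a class of `m` vertices of equal weight by one vertex and rescaling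
the weights of the class, for an edge with `k` vertices in the class. -/
theorem one_add_mul_le_clone_gain {α : ℝ} (hα : 0 < α) {m k : ℕ} (hm : 0 < m)
    (hc : 0 ≤ 1 - 1 / α - 1 / (α * m)) (hk : k ≤ m) :
    1 + k / m * (1 - 1 / α - 1 / (α * m)) ≤
      (((m : ℝ) / (m + 1)) ^ (1 / α)) ^ k * (1 + k / (m + 1 - k)) := by
  have hm' : (0 : ℝ) < m := by exact_mod_cast hm
  have hk' : (k : ℝ) ≤ m := by exact_mod_cast hk
  have hd : (0 : ℝ) < m + 1 - k := by linarith
  have h1 : 1 - k / α * (1 / m) ≤ (((m : ℝ) / (m + 1)) ^ (1 / α)) ^ k := by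
    refine (one_sub_mul_le_rpow_neg (by positivity) (by positivity)).trans_eq ?_
    rw [← Real.rpow_natCast, ← Real.rpow_mul (by positivity), Real.rpow_neg (by positivity),
      ← Real.inv_rpow (by positivity)]
    congr 1
    · field_simp
    · ring
  have h2 : (k : ℝ) / m ≤ k / (m + 1 - k) := by
    rcases Nat.eq_zero_or_pos k with rfl | h
    · simp
    · have : (1 : ℝ) ≤ k := by exact_mod_cast h
      gcongr
      linarith
  calc 1 + k / m * (1 - 1 / α - 1 / (α * m))
      ≤ 1 + k / (m + 1 - k) * (1 - 1 / α - 1 / (α * m)) := by gcongr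
    _ = (1 - k / α * (1 / m)) * (1 + k / (m + 1 - k)) := by field_simp; ring
    _ ≤ _ := by
      gcongr

namespace UniformHypergraph

section Clone

variable {r : ℕ} {P : Pattern r}

/-- Double counting of the pairs of an edge through `z` and a vertex `w` of the class of `z`
outside it: swapping `z` and `w` turns these into the edges that avoid `z`, together with
one of their vertices in the class. -/
theorem sum_edges_clone_ge {V : Type*} [Fintype V] [DecidableEq V] {ψ : V → Fin P.l} {z : V}
    {y : V → ℝ} (hy : ∀ v, 0 ≤ y v) (hconst : ∀ w, ψ w = ψ z → y w = y z) {C : Finset V}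
    (hC : ∀ w, w ∈ C ↔ w ≠ z ∧ ψ w = ψ z) :
    ∑ e ∈ (complete P ψ).edges with z ∉ e,
        ((e ∩ C).card : ℝ) / (C.card + 1 - (e ∩ C).card) * ∏ i ∈ e, y i ≤
      ∑ e ∈ (complete P ψ).edges with z ∈ e, ∏ i ∈ e, y i := by
  have hzC : z ∉ C := fun h => ((hC z).1 h).1 rfl
  set D := insert z C with hD
  set g : Finset V → ℝ := fun e => ((C.card : ℝ) + 1 - (e ∩ D).card)⁻¹ * ∏ i ∈ e, y i with hg
  have hgswap : ∀ w ∈ C, ∀ e : Finset V,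
      g (e.map (Equiv.swap w z).toEmbedding) = g e := by
    intro w hw e
    have hwψ := ((hC w).1 hw).2
    have hDmap : D.map (Equiv.swap w z).toEmbedding = D := by
      ext v
      rw [Finset.mem_map_equiv, Equiv.symm_swap]
      by_cases hvw : v = w
      · subst hvw; simp [hD, hw]
      · by_cases hvz : v = z
        · subst hvz; simp [hD, hw]
        · rw [Equiv.swap_apply_of_ne_of_ne hvw hvz]
    have hyswap : ∀ v, y (Equiv.swap w z v) = y v := by
      intro v
      by_cases hvw : v = w
      · subst hvw; simp [hconst v hwψ]
      · by_cases hvz : v = z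
        · subst hvz; simp [hconst w hwψ]
        · rw [Equiv.swap_apply_of_ne_of_ne hvw hvz]
    simp only [hg]
    congr 1
    · nth_rewrite 1 [← hDmap]
      rw [← Finset.map_inter, Finset.card_map]
    · rw [Finset.prod_map]
      exact Finset.prod_congr rfl fun v _ => hyswap v
  have hswap : ∑ w ∈ C, ∑ e ∈ (complete P ψ).edges with z ∈ e ∧ w ∉ e, g e =
      ∑ w ∈ C, ∑ e ∈ (complete P ψ).edges with w ∈ e ∧ z ∉ e, g e := by
    refine Finset.sum_congr rfl fun w hw => ?_
    rw [sum_complete_swap (φ := ψ) (u := w) (v := z) (fun _ _ => rfl) ((hC w).1 hw).2.symm]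
    exact Finset.sum_congr rfl fun e _ => hgswap w hw e
  have hl : ∑ w ∈ C, ∑ e ∈ (complete P ψ).edges with z ∈ e ∧ w ∉ e, g e =
      ∑ e ∈ (complete P ψ).edges with z ∈ e, ((C \ e).card : ℝ) * g e := by
    rw [Finset.sum_congr rfl fun w _ => by
      rw [← Finset.filter_filter (fun e => z ∈ e) (fun e => w ∉ e), Finset.sum_filter],
      Finset.sum_comm]
    refine Finset.sum_congr rfl fun e _ => ?_
    rw [← Finset.sum_filter, Finset.sum_const, nsmul_eq_mul, Finset.sdiff_eq_filter]
  have hrr : ∑ w ∈ C, ∑ e ∈ (complete P ψ).edges with w ∈ e ∧ z ∉ e, g e =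
      ∑ e ∈ (complete P ψ).edges with z ∉ e, ((e ∩ C).card : ℝ) * g e := by
    rw [Finset.sum_congr rfl fun w _ => by
      rw [← Finset.filter_filter (fun e => w ∈ e) (fun e => z ∉ e), Finset.filter_comm,
        Finset.sum_filter], Finset.sum_comm]
    refine Finset.sum_congr rfl fun e _ => ?_
    rw [← Finset.sum_filter, Finset.sum_const, nsmul_eq_mul, Finset.filter_mem_eq_inter,
      Finset.inter_comm]
  rw [hl, hrr] at hswap
  calc _ = ∑ e ∈ (complete P ψ).edges with z ∉ e, ((e ∩ C).card : ℝ) * g e := by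
        refine Finset.sum_congr rfl fun e he => ?_
        have : e ∩ D = e ∩ C := Finset.inter_insert_of_notMem (Finset.mem_filter.1 he).2
        simp only [hg, this]
        ring
    _ = ∑ e ∈ (complete P ψ).edges with z ∈ e, ((C \ e).card : ℝ) * g e := hswap.symm
    _ ≤ _ := by
        refine Finset.sum_le_sum fun e he => ?_
        have hcard : ((e ∩ D).card : ℝ) = (e ∩ C).card + 1 := by
          have : e ∩ D = insert z (e ∩ C) :=
            Finset.inter_insert_of_mem (Finset.mem_filter.1 he).2
          rw [this, Finset.card_insert_of_notMem fun h => hzC (Finset.mem_inter.1 h).2]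
          push_cast
          ring
        have hsd : ((C \ e).card : ℝ) = C.card - (e ∩ C).card := by
          rw [eq_sub_iff_add_eq, Finset.inter_comm]
          exact_mod_cast Finset.card_sdiff_add_card_inter C e
        have hprod : 0 ≤ ∏ i ∈ e, y i := Finset.prod_nonneg fun i _ => hy i
        simp only [hg]
        rw [hcard, show (C.card : ℝ) + 1 - ((e ∩ C).card + 1) = (C \ e).card by rw [hsd]; ring,
          ← mul_assoc]
        -- The factor is `1`, or `0` when the whole class lies in `e`.
        exact mul_le_of_le_one_left hprod mul_inv_le_one

/-- Adding a vertex to a class of `m` vertices increases the spectral radius by a factor of at least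
`1 + r * (1 - 1 / α - 1 / (α * m)) * a ^ α`. The test vector spreads the `α`-mass of the class
evenly over `m + 1` vertices, which keeps the norm, and Euler's identity restricted to the class
evaluates the resulting sum. -/
theorem spectralRadius_clone_ge {n : ℕ} {α : ℝ} (hα : 1 < α) (hr : r ≠ 0)
    {φ : Fin n → Fin P.l} {x : Fin n → ℝ} (hx : x ∈ (complete P φ).principalEigenvectors α)
    {i : Fin P.l} {a : ℝ} (ha : ∀ v, φ v = i → x v = a) {m : ℕ}
    (hm : (Finset.univ.filter fun v => φ v = i).card = m) (hm0 : 0 < m)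
    (hc : 0 ≤ 1 - 1 / α - 1 / (α * m)) :
    (1 + r * (1 - 1 / α - 1 / (α * m)) * a ^ α) * (complete P φ).spectralRadius α ≤
      (complete P (Fin.snoc (α := fun _ => Fin P.l) φ i :
        Fin (n + 1) → Fin P.l)).spectralRadius α := by
  have hα0 : 0 < α := by linarith
  have hm' : (0 : ℝ) < m := by exact_mod_cast hm0
  set ψ : Fin (n + 1) → Fin P.l := Fin.snoc (α := fun _ => Fin P.l) φ i with hψ
  set S := Finset.univ.filter fun v => φ v = i with hS
  -- The ratio is chosen so that `(m + 1) * (ρ * a) ^ α = m * a ^ α`.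
  set ρ : ℝ := ((m : ℝ) / (m + 1)) ^ (1 / α) with hρ
  have hρ0 : 0 ≤ ρ := by positivity
  have hρα : ρ ^ α = m / (m + 1) := by
    rw [hρ, ← Real.rpow_mul (by positivity), one_div_mul_cancel hα0.ne', Real.rpow_one]
  have ha0 : 0 ≤ a := by
    obtain ⟨v, hv⟩ := Finset.card_pos.1 (hm ▸ hm0)
    rw [← ha v (Finset.mem_filter.1 hv).2]
    exact hx.1 v
  set y : Fin (n + 1) → ℝ :=
    Fin.snoc (α := fun _ => ℝ) (fun v => (if φ v = i then ρ else 1) * x v) (ρ * a) with hy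
  have hycast : ∀ v, y (Fin.castSucc v) = (if φ v = i then ρ else 1) * x v := fun v =>
    Fin.snoc_castSucc (α := fun _ => ℝ) _ _ v
  have hylast : y (Fin.last n) = ρ * a := Fin.snoc_last (α := fun _ => ℝ) _ _
  have hψcast : ∀ v, ψ (Fin.castSucc v) = φ v := fun v =>
    Fin.snoc_castSucc (α := fun _ => Fin P.l) _ _ v
  have hψlast : ψ (Fin.last n) = i := Fin.snoc_last (α := fun _ => Fin P.l) _ _
  have hy0 : ∀ v, 0 ≤ y v := by
    intro v
    induction v using Fin.lastCases with
    | last => rw [hylast]; positivity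
    | cast v =>
      rw [hycast]
      exact mul_nonneg (by split_ifs <;> positivity) (hx.1 v)
  have hsumx := sum_rpow_of_principal hα0 hx
  have hsumS : ∑ v ∈ S, x v ^ α = m * a ^ α := by
    rw [Finset.sum_congr rfl fun v hv => by rw [ha v (Finset.mem_filter.1 hv).2],
      Finset.sum_const, nsmul_eq_mul, hm]
  have hsumy : ∑ v, |y v| ^ α = 1 := by
    have hterm : ∀ v, ((if φ v = i then ρ else 1) * x v) ^ α =
        x v ^ α - (1 - ρ ^ α) * (if φ v = i then x v ^ α else 0) := by
      intro v
      split_ifs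
      · rw [Real.mul_rpow hρ0 (hx.1 v)]; ring
      · simp
    simp_rw [abs_of_nonneg (hy0 _)]
    rw [Fin.sum_univ_castSucc]
    simp_rw [hycast, hterm]
    rw [hylast, Finset.sum_sub_distrib, ← Finset.mul_sum, ← Finset.sum_filter, ← hS, hsumS,
      hsumx, Real.mul_rpow hρ0 ha0, hρα]
    field_simp
    ring
  refine le_trans ?_ ((complete P ψ).lagrangian_le_spectralRadius hα0 hsumy)
  have hconst : ∀ w, ψ w = ψ (Fin.last n) → y w = y (Fin.last n) := by
    intro w hw
    induction w using Fin.lastCases with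
    | last => rfl
    | cast v =>
      rw [hψcast, hψlast] at hw
      rw [hycast, hylast, if_pos hw, ha v hw]
  have hC : ∀ w, w ∈ S.map Fin.castSuccEmb ↔ w ≠ Fin.last n ∧ ψ w = ψ (Fin.last n) := by
    intro w
    induction w using Fin.lastCases with
    | last => simp
    | cast v =>
      rw [hψcast, hψlast]
      simp [hS, Fin.castSucc_ne_last]
  have hclone := sum_edges_clone_ge hy0 hconst hC
  -- The edges that avoid the new vertex are the edges of the old graph.
  have hbij : ∀ F : Finset (Fin (n + 1)) → ℝ,
      ∑ e ∈ (complete P ψ).edges with Fin.last n ∉ e, F e =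
        ∑ e ∈ (complete P φ).edges, F (e.map Fin.castSuccEmb) := by
    intro F
    have himg : (complete P ψ).edges.filter (fun e => Fin.last n ∉ e) =
        (complete P φ).edges.image fun e => e.map Fin.castSuccEmb := by
      ext e
      rw [Finset.mem_filter, Finset.mem_image]
      constructor
      · rintro ⟨he, hz⟩
        have hmap : (Finset.univ.filter fun v : Fin n => v.castSucc ∈ e).map Fin.castSuccEmb
            = e := by
          ext w
          induction w using Fin.lastCases with
          | last => simp [hz]
          | cast v => simp
        refine ⟨_, ?_, hmap⟩
        rw [← hmap] at he
        exact (map_mem_complete_edges _ fun v _ => hψcast v).1 he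
      · rintro ⟨f, hf, rfl⟩
        exact ⟨(map_mem_complete_edges _ fun v _ => hψcast v).2 hf, by simp⟩
    rw [himg, Finset.sum_image fun _ _ _ _ h => Finset.map_injective _ h]
  rw [hbij] at hclone
  have hk : ∀ e : Finset (Fin n),
      (e.map Fin.castSuccEmb ∩ S.map Fin.castSuccEmb).card = (e ∩ S).card := fun e => by
    rw [← Finset.map_inter, Finset.card_map]
  have hprod : ∀ e : Finset (Fin n), ∏ v ∈ e.map Fin.castSuccEmb, y v =
      ρ ^ (e ∩ S).card * ∏ v ∈ e, x v := by
    intro e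
    rw [Finset.prod_map]
    simp only [Fin.coe_castSuccEmb, hycast]
    rw [Finset.prod_mul_distrib, Finset.prod_ite, Finset.prod_const, Finset.prod_const_one,
      mul_one]
    congr 3
    ext v
    simp [hS]
  have hEuler := sum_mul_linkSum (complete P φ) x S
  have hlink : r.factorial * ∑ u ∈ S, x u * (complete P φ).linkSum x u =
      r * (complete P φ).spectralRadius α * (m * a ^ α) := by
    rw [← hsumS, Finset.mul_sum, Finset.mul_sum]
    refine Finset.sum_congr rfl fun u _ => ?_
    rw [mul_left_comm, linkSum_of_principal hα hr hx u]
    rcases (hx.1 u).eq_or_lt with h | h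
    · rw [← h, Real.zero_rpow hα0.ne', zero_mul, mul_zero]
    · rw [Real.rpow_sub_one h.ne']
      field_simp
  rw [hEuler] at hlink
  set c := 1 - 1 / α - 1 / (α * m) with hcdef
  have hsplit : ∑ e ∈ (complete P ψ).edges, ∏ v ∈ e, y v =
      ∑ e ∈ (complete P ψ).edges with Fin.last n ∈ e, ∏ v ∈ e, y v +
        ∑ e ∈ (complete P φ).edges, ∏ v ∈ e.map Fin.castSuccEmb, y v := by
    rw [← hbij fun e => ∏ v ∈ e, y v, Finset.sum_filter_add_sum_filter_not]
  have hmain : ∑ e ∈ (complete P φ).edges, ∏ v ∈ e, x v +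
      c / m * ∑ e ∈ (complete P φ).edges, ((e ∩ S).card : ℝ) * ∏ v ∈ e, x v ≤
        ∑ e ∈ (complete P ψ).edges, ∏ v ∈ e, y v := by
    rw [hsplit]
    refine le_trans ?_ (add_le_add_left hclone _)
    rw [Finset.mul_sum, ← Finset.sum_add_distrib, ← Finset.sum_add_distrib]
    refine Finset.sum_le_sum fun e _ => ?_
    rw [hk, hprod, Finset.card_map, hm]
    have hle : (e ∩ S).card ≤ m := hm ▸ Finset.card_le_card Finset.inter_subset_right
    have hgain := one_add_mul_le_clone_gain hα0 hm0 hc hle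
    have hp : 0 ≤ ∏ v ∈ e, x v := Finset.prod_nonneg fun v _ => hx.1 v
    have := mul_le_mul_of_nonneg_right hgain hp
    rw [← hcdef, ← hρ] at this
    calc _ = (1 + (e ∩ S).card / m * c) * ∏ v ∈ e, x v := by ring
      _ ≤ _ := this
      _ = _ := by ring
  have hL := hx.2.2
  unfold lagrangian at hL ⊢
  refine le_trans (le_of_eq ?_) (mul_le_mul_of_nonneg_left hmain (by positivity))
  rw [mul_add, hL, mul_left_comm, hlink]
  field_simp

end Clone

end UniformHypergraph

/-! ### Entries of principal eigenvectors and degrees -/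

/-- For `n ≥ 2 * r` each of the `r` factors of the falling factorial is at least `n / 2`. -/
theorem half_pow_le_factorial_mul_choose {n r : ℕ} (hn : 2 * r ≤ n) :
    (n : ℝ) ^ r ≤ 2 ^ r * (r.factorial * n.choose r) := by
  have h1 : ((n + 1 - r : ℕ) : ℝ) ^ r ≤ (r.factorial * n.choose r : ℝ) := by
    have := Nat.pow_sub_le_descFactorial n r
    rw [Nat.descFactorial_eq_factorial_mul_choose] at this
    exact_mod_cast this
  have h2 : (n : ℝ) ≤ 2 * ((n + 1 - r : ℕ) : ℝ) := by
    have : n ≤ 2 * (n + 1 - r) := by omega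
    exact_mod_cast this
  calc (n : ℝ) ^ r ≤ (2 * ((n + 1 - r : ℕ) : ℝ)) ^ r := by gcongr
    _ = 2 ^ r * ((n + 1 - r : ℕ) : ℝ) ^ r := mul_pow _ _ _
    _ ≤ _ := by gcongr

namespace UniformHypergraph

section Bounds

variable {V : Type*} [Fintype V] {r : ℕ} {α : ℝ}

theorem xMin_nonneg [Nonempty V] (hα : 0 < α) (G : UniformHypergraph V r) : 0 ≤ G.xMin α := by
  refine le_csInf ((G.principalEigenvectors_nonempty hα).image _) ?_
  rintro _ ⟨x, hx, rfl⟩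
  exact le_ciInf hx.1

theorem xMin_le {G : UniformHypergraph V r} {x : V → ℝ} (hx : x ∈ G.principalEigenvectors α)
    (v : V) : G.xMin α ≤ x v := by
  have : Nonempty V := ⟨v⟩
  refine le_trans (csInf_le ⟨0, ?_⟩ ⟨x, hx, rfl⟩) (ciInf_le (Set.finite_range x).bddBelow v)
  rintro _ ⟨y, hy, rfl⟩
  exact le_ciInf hy.1

theorem le_xMin_rpow [Nonempty V] (hα : 0 < α) {G : UniformHypergraph V r} {t : ℝ} (ht : 0 ≤ t)
    (h : ∀ x ∈ G.principalEigenvectors α, ∀ v, t ≤ x v ^ α) : t ≤ G.xMin α ^ α := by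
  have hle : t ^ (1 / α) ≤ G.xMin α := by
    refine le_csInf ((G.principalEigenvectors_nonempty hα).image _) ?_
    rintro _ ⟨x, hx, rfl⟩
    refine le_ciInf fun v => ?_
    calc t ^ (1 / α) ≤ (x v ^ α) ^ (1 / α) := Real.rpow_le_rpow ht (h x hx v) (by positivity)
      _ = x v := by
        rw [← Real.rpow_mul (hx.1 v), mul_one_div_cancel hα.ne', Real.rpow_one]
  calc t = (t ^ (1 / α)) ^ α := by
        rw [← Real.rpow_mul ht, one_div_mul_cancel hα.ne', Real.rpow_one]
    _ ≤ _ := by gcongr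

/-- A division-free form of the bound `T ^ (r - 2)` that also covers `r = 1`, where no edge contains
two vertices and truncated subtraction would give the wrong exponent. -/
theorem sum_pair_link_mul_sq_le [DecidableEq V] (hr : r ≠ 0) (G : UniformHypergraph V r) {x : V → ℝ}
    (hx : ∀ i, 0 ≤ x i) {T : ℝ} (hT : ∑ i, x i ≤ T) {u v : V} (huv : u ≠ v) :
    (∑ e ∈ G.edges with u ∈ e ∧ v ∈ e, ∏ i ∈ (e.erase u).erase v, x i) * T ^ 2 ≤ T ^ r := by
  have h0 : 0 ≤ ∑ i, x i := Finset.sum_nonneg fun i _ => hx i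
  by_cases h1 : r = 1
  · have hempty : G.edges.filter (fun e => u ∈ e ∧ v ∈ e) = ∅ := by
      refine Finset.filter_eq_empty_iff.2 fun e he ⟨hu, hv⟩ => huv ?_
      exact Finset.card_le_one.1 ((G.uniform e he).trans h1).le u hu v hv
    rw [hempty, Finset.sum_empty, zero_mul]
    exact pow_nonneg (h0.trans hT) r
  · calc _ ≤ T ^ (r - 2) * T ^ 2 := by
          gcongr
          exact (G.sum_pair_link_le hx huv).trans (by gcongr)
      _ = T ^ r := by rw [← pow_add]; congr 1; omega

/-- The eigenequation at `v`, with every other entry replaced by the upper bound `A`. -/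
theorem mul_rpow_le_degree_mul_pow (hα : 1 < α) (hr : r ≠ 0) {G : UniformHypergraph V r}
    {x : V → ℝ} (hx : x ∈ G.principalEigenvectors α) {A : ℝ} (hA : ∀ i, x i ≤ A) (v : V) :
    r * G.spectralRadius α * x v ^ (α - 1) ≤ r.factorial * (G.degree v * A ^ (r - 1)) := by
  classical
  rw [← linkSum_of_principal hα hr hx v]
  gcongr
  unfold linkSum degree
  rw [← nsmul_eq_mul]
  have : ∀ e ∈ G.edges.filter (fun e => v ∈ e), ∏ i ∈ e.erase v, x i ≤ A ^ (r - 1) := by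
    intro e he
    rw [Finset.mem_filter] at he
    rw [← G.uniform e he.1, ← Finset.card_erase_of_mem he.2, ← Finset.prod_const]
    exact Finset.prod_le_prod (fun i _ => hx.1 i) fun i _ => hA i
  convert Finset.sum_le_card_nsmul _ _ _ this

theorem exists_minDegree_eq_degree [Nonempty V] (G : UniformHypergraph V r) :
    ∃ v, G.minDegree = G.degree v := by
  obtain ⟨v, hv⟩ := exists_eq_ciInf_of_finite (f := fun v => G.degree v)
  exact ⟨v, hv.symm⟩

end Bounds

section Extremal

variable {r n : ℕ} {P : Pattern r} {α : ℝ}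

/-- The completion of an extremal graph with respect to its colouring has the same spectral
radius, and so inherits the principal eigenvectors. -/
theorem principal_complete_of_extremal (hα : 0 < α) {G : UniformHypergraph (Fin n) r}
    (hG : G ∈ spectralExtremal α (Col P) n) :
    ∃ φ : Fin n → Fin P.l,
      (complete P φ).spectralRadius α = maxSpectralRadius α (Col P) n ∧
        G.principalEigenvectors α ⊆ (complete P φ).principalEigenvectors α := by
  obtain ⟨⟨φ, hφ⟩, hmax⟩ := hG
  have key : ∀ x ∈ G.principalEigenvectors α,
      (complete P φ).lagrangian x = maxSpectralRadius α (Col P) n ∧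
        (complete P φ).spectralRadius α = maxSpectralRadius α (Col P) n := by
    intro x hx
    have h1 := lagrangian_mono hφ.edges_subset hx.1
    have h2 := (complete P φ).lagrangian_le_spectralRadius hα
      ((alphaNorm_eq_one_iff hα x).1 hx.2.1)
    have h3 := spectralRadius_le_maxSpectralRadius α (complete_mem_Col φ)
    rw [hx.2.2, hmax] at h1
    exact ⟨by linarith, by linarith⟩
  rcases Nat.eq_zero_or_pos n with rfl | hn
  · have hnorm : {x : Fin 0 → ℝ | alphaNorm α x = 1} = ∅ := by
      refine Set.eq_empty_of_forall_notMem fun x hx => ?_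
      have := (alphaNorm_eq_one_iff hα x).1 hx
      simp at this
    refine ⟨φ, ?_, fun x hx => absurd hx.2.1 fun h => hnorm.le h⟩
    rw [← hmax]
    unfold spectralRadius
    rw [hnorm, Set.image_empty, Set.image_empty]
  · have : Nonempty (Fin n) := ⟨⟨0, hn⟩⟩
    obtain ⟨x, hx⟩ := G.principalEigenvectors_nonempty hα
    refine ⟨φ, (key x hx).2, fun x hx => ⟨hx.1, hx.2.1, ?_⟩⟩
    rw [(key x hx).1, (key x hx).2]

/-- The power mean inequality. -/
theorem sum_le_card_mul_of_principal (hα : 1 < α) (hn : 0 < n) {G : UniformHypergraph (Fin n) r}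
    {x : Fin n → ℝ} (hx : x ∈ G.principalEigenvectors α) :
    ∑ i, x i ≤ n * (n : ℝ) ^ (-(1 / α)) := by
  have hα0 : 0 < α := by linarith
  have hn' : (0 : ℝ) < n := by exact_mod_cast hn
  have h0 : 0 ≤ ∑ i, x i := Finset.sum_nonneg fun i _ => hx.1 i
  have h := Real.rpow_sum_le_const_mul_sum_rpow Finset.univ x hα.le
  simp_rw [abs_of_nonneg (hx.1 _)] at h
  rw [sum_rpow_of_principal hα0 hx, mul_one, Finset.card_univ, Fintype.card_fin] at h
  refine (Real.rpow_le_rpow_iff h0 (by positivity) hα0).1 (h.trans_eq ?_)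
  rw [Real.mul_rpow hn'.le (by positivity), ← Real.rpow_mul hn'.le, neg_mul,
    one_div_mul_cancel hα0.ne', ← Real.rpow_add hn']
  rfl

theorem maxSpectralRadius_ge (P : Pattern r) (hα : 0 < α) (hn : 2 * r ≤ n) (hn0 : 0 < n)
    (hπ : 0 ≤ edgeDensity (Col P)) :
    edgeDensity (Col P) * ((n : ℝ) * (n : ℝ) ^ (-(1 / α))) ^ r ≤
      2 ^ r * maxSpectralRadius α (Col P) n := by
  have h1 := le_maxSpectralRadius P hα (by omega : r ≤ n) hn0
  have h2 := half_pow_le_factorial_mul_choose hn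
  have hs : (0 : ℝ) ≤ (n : ℝ) ^ (-(1 / α)) := by positivity
  rw [mul_pow]
  calc _ ≤ edgeDensity (Col P) * ((2 ^ r * (r.factorial * n.choose r)) *
        ((n : ℝ) ^ (-(1 / α))) ^ r) := by gcongr
    _ = 2 ^ r * (r.factorial * (edgeDensity (Col P) * n.choose r) *
        ((n : ℝ) ^ (-(1 / α))) ^ r) := by ring
    _ ≤ _ := by gcongr

/-- The entries of a principal eigenvector of an extremal complete graph are all close to
`n ^ (-1 / α)`: recolouring a vertex of smallest entry with the colour of any other vertex bounds
the spread of the entries. -/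
theorem entries_of_principal (hα : 1 < α) (hr : r ≠ 0) (hπ : 0 < edgeDensity (Col P))
    (hn : 2 * r ≤ n) {φ : Fin n → Fin P.l}
    (hφ : (complete P φ).spectralRadius α = maxSpectralRadius α (Col P) n)
    {x : Fin n → ℝ} (hx : x ∈ (complete P φ).principalEigenvectors α) (w : Fin n) {K : ℝ}
    (hK : K = r.factorial * 2 ^ r / (r * edgeDensity (Col P))) :
    ((n : ℝ) ^ (-(1 / α))) ^ (α - 1) * (1 - K / n) ≤ x w ^ (α - 1) ∧
      x w ^ (α - 1) ≤ ((n : ℝ) ^ (-(1 / α))) ^ (α - 1) * (1 + K / n) := by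
  have hα0 : 0 < α := by linarith
  have hn0 : 0 < n := by have := Nat.pos_of_ne_zero hr; omega
  have hn' : (0 : ℝ) < n := by exact_mod_cast hn0
  have hr' : (0 : ℝ) < r := by exact_mod_cast Nat.pos_of_ne_zero hr
  have : Nonempty (Fin n) := ⟨⟨0, hn0⟩⟩
  set s := (n : ℝ) ^ (-(1 / α)) with hs
  have hs0 : 0 < s := by positivity
  have hsα : s ^ α = 1 / n := by
    rw [hs, ← Real.rpow_mul hn'.le, neg_mul, one_div_mul_cancel hα0.ne', Real.rpow_neg_one,
      one_div]
  have hsα' : s * s ^ (α - 1) = 1 / n := by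
    rw [← hsα, Real.rpow_sub_one hs0.ne']
    field_simp
  set Λ := (complete P φ).spectralRadius α with hΛ
  have hmax := maxSpectralRadius_ge P hα0 hn hn0 hπ.le
  rw [← hφ, ← hs] at hmax
  have hΛpos : 0 < Λ := by
    have : 0 < edgeDensity (Col P) * (n * s) ^ r := by positivity
    have : 0 < 2 ^ r * Λ := this.trans_le hmax
    exact pos_of_mul_pos_right this (by positivity)
  have hK0 : 0 ≤ K := by rw [hK]; positivity
  -- The average of the numbers `x i ^ α` is `s ^ α`.
  have hsum := sum_rpow_of_principal hα0 hx
  have hsums : ∑ _i : Fin n, s ^ α = 1 := by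
    rw [Finset.sum_const, Finset.card_univ, Fintype.card_fin, nsmul_eq_mul, hsα]
    field_simp
  obtain ⟨u, -, hu⟩ := Finset.exists_le_of_sum_le (s := Finset.univ)
    (f := fun _ => s ^ α) (g := fun i => x i ^ α) Finset.univ_nonempty (by rw [hsum, hsums])
  obtain ⟨v', -, hv'⟩ := Finset.exists_le_of_sum_le (s := Finset.univ)
    (f := fun i => x i ^ α) (g := fun _ => s ^ α) Finset.univ_nonempty (by rw [hsum, hsums])
  have hu : s ≤ x u := (Real.rpow_le_rpow_iff hs0.le (hx.1 u) hα0).1 hu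
  have hv' : x v' ≤ s := (Real.rpow_le_rpow_iff (hx.1 v') hs0.le hα0).1 hv'
  obtain ⟨v, hv⟩ := Finite.exists_min x
  have hvs : x v ≤ s := (hv v').trans hv'
  have hspread : ∀ u, x u ^ (α - 1) ≤ x v ^ (α - 1) + s ^ (α - 1) * (K / n) := by
    intro u
    by_cases huv : u = v
    · subst huv
      exact le_add_of_nonneg_right (by positivity)
    have hrec := rpow_le_of_recolor (ψ := Function.update φ v (φ u)) hα hr hx huv
      (fun w hw => Function.update_of_ne hw _ _) (Function.update_self _ _ _)
      ((spectralRadius_le_maxSpectralRadius α (complete_mem_Col _)).trans_eq hφ.symm)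
    have hD := (complete P φ).sum_pair_link_mul_sq_le hr hx.1
      (sum_le_card_mul_of_principal hα hn0 hx) huv
    rw [← hs] at hD
    rw [← hΛ] at hrec
    set D := ∑ e ∈ (complete P φ).edges with u ∈ e ∧ v ∈ e, ∏ i ∈ (e.erase u).erase v, x i
    have hD0 : 0 ≤ D := Finset.sum_nonneg fun e _ => Finset.prod_nonneg fun i _ => hx.1 i
    have h1 : r.factorial * (x v * D) ≤ r * Λ * (s ^ (α - 1) * (K / n)) := by
      -- The lower bound on `Λ` is what determines `K`.
      have h2 : D * (n * s) ^ 2 ≤ 2 ^ r * Λ / edgeDensity (Col P) := by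
        rw [le_div_iff₀ hπ, mul_comm]
        exact (mul_le_mul_of_nonneg_left hD hπ.le).trans hmax
      calc r.factorial * (x v * D) ≤ r.factorial * (s * D) := by gcongr
        _ = r.factorial * (D * (n * s) ^ 2) * (s ^ (α - 1) / n) := by
          have h3 : s * (s * s ^ (α - 1)) * n = s := by rw [hsα']; field_simp
          calc r.factorial * (s * D) =
              r.factorial * ((s * (s * s ^ (α - 1)) * n) * D) := by rw [h3]
            _ = _ := by field_simp
        _ ≤ r.factorial * (2 ^ r * Λ / edgeDensity (Col P)) * (s ^ (α - 1) / n) := by gcongr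
        _ = _ := by rw [hK]; field_simp
    have hrΛ : 0 < r * Λ := by positivity
    refine le_of_mul_le_mul_left (a := r * Λ) ?_ hrΛ
    rw [mul_add]
    linarith
  have hp : 0 ≤ α - 1 := by linarith
  constructor
  · have h1 := hspread u
    have h2 : s ^ (α - 1) ≤ x u ^ (α - 1) := by gcongr
    have h3 : x v ^ (α - 1) ≤ x w ^ (α - 1) := Real.rpow_le_rpow (hx.1 v) (hv w) hp
    rw [mul_sub, mul_one]
    linarith
  · have h1 := hspread w
    have h2 : x v ^ (α - 1) ≤ s ^ (α - 1) := Real.rpow_le_rpow (hx.1 v) hvs hp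
    rw [mul_add, mul_one]
    linarith

/-- Bernoulli's inequality turns the lower bound on `a ^ (α - 1)` into one on `a ^ α`. -/
theorem rpow_ge_of_entry_ge (hα : 1 < α) (hn : 0 < n) {K a : ℝ} (hK : K ≤ n) (ha : 0 ≤ a)
    (h : ((n : ℝ) ^ (-(1 / α))) ^ (α - 1) * (1 - K / n) ≤ a ^ (α - 1)) :
    1 / (n : ℝ) * (1 - α / (α - 1) * K / n) ≤ a ^ α := by
  have hα0 : 0 < α := by linarith
  have hα1 : 0 < α - 1 := by linarith
  have hn' : (0 : ℝ) < n := by exact_mod_cast hn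
  have hKn : K / n ≤ 1 := (div_le_one hn').2 hK
  have hpow : ∀ {b : ℝ}, 0 ≤ b → (b ^ (α - 1)) ^ (α / (α - 1)) = b ^ α := by
    intro b hb
    rw [← Real.rpow_mul hb, mul_div_cancel₀ _ hα1.ne']
  have h1 : 1 + α / (α - 1) * -(K / n) ≤ (1 + -(K / n)) ^ (α / (α - 1)) :=
    one_add_mul_self_le_rpow_one_add (by linarith) ((one_le_div hα1).2 (by linarith))
  have h2 := Real.rpow_le_rpow (mul_nonneg (by positivity) (by linarith)) h
    (div_nonneg hα0.le hα1.le)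
  rw [Real.mul_rpow (by positivity) (by linarith), hpow (by positivity), hpow ha,
    ← Real.rpow_mul hn'.le, neg_mul, one_div_mul_cancel hα0.ne', Real.rpow_neg_one,
    ← one_div] at h2
  refine le_trans ?_ h2
  gcongr
  calc _ = 1 + α / (α - 1) * -(K / n) := by ring
    _ ≤ _ := h1
    _ = _ := by rw [← sub_eq_add_neg]

/-- If the entries are nearly equal, then the eigenequation at `v` and the lower bound on the
spectral radius make the degree of `v` large. -/
theorem degree_ge_of_principal (hα : 1 < α) (hr : r ≠ 0) (hπ : 0 < edgeDensity (Col P))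
    (hn : 2 * r ≤ n) {G : UniformHypergraph (Fin n) r} {x : Fin n → ℝ}
    (hx : x ∈ G.principalEigenvectors α)
    (hG : G.spectralRadius α = maxSpectralRadius α (Col P) n) {K : ℝ} (hK0 : 0 ≤ K)
    (hK : K ≤ n)
    (hlow : ∀ w, ((n : ℝ) ^ (-(1 / α))) ^ (α - 1) * (1 - K / n) ≤ x w ^ (α - 1))
    (hup : ∀ w, x w ^ (α - 1) ≤ ((n : ℝ) ^ (-(1 / α))) ^ (α - 1) * (1 + K / n)) (v : Fin n) :
    edgeDensity (Col P) * (1 - ((r - 1) + K + (r - 1) / (α - 1) * K) / n) *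
      n.choose (r - 1) ≤ G.degree v := by
  have hα0 : 0 < α := by linarith
  have hα1 : 0 < α - 1 := by linarith
  have hr1 : 1 ≤ r := Nat.one_le_iff_ne_zero.2 hr
  have hn0 : 0 < n := by omega
  have hn' : (0 : ℝ) < n := by exact_mod_cast hn0
  have hr' : (1 : ℝ) ≤ r := by exact_mod_cast hr1
  have hrn : (r : ℝ) ≤ n := by exact_mod_cast (by omega : r ≤ n)
  have hKn : K / n ≤ 1 := (div_le_one hn').2 hK
  have hKn0 : 0 ≤ K / n := by positivity
  have hΛ := le_maxSpectralRadius P hα0 (by omega : r ≤ n) hn0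
  rw [← hG] at hΛ
  set s := (n : ℝ) ^ (-(1 / α)) with hs
  have hs0 : 0 < s := by positivity
  have hsα : s ^ r * s ^ (α - 1) = s ^ (r - 1) / n := by
    have h1 : s ^ α = 1 / n := by
      rw [hs, ← Real.rpow_mul hn'.le, neg_mul, one_div_mul_cancel hα0.ne', Real.rpow_neg_one,
        one_div]
    rw [← Nat.sub_add_cancel hr1, Nat.add_sub_cancel, pow_succ, Real.rpow_sub_one hs0.ne', h1]
    field_simp
  set p := ((r : ℝ) - 1) / (α - 1) with hp
  have hp0 : 0 ≤ p := div_nonneg (by linarith) hα1.le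
  set B := (1 + K / n) ^ p with hB
  have hB0 : 0 < B := by positivity
  have hBinv : 1 - p * (K / n) ≤ B⁻¹ := by
    rw [hB, ← Real.rpow_neg (by positivity)]
    exact one_sub_mul_le_rpow_neg hKn0 hp0
  -- An upper bound on all entries; `B` is the ratio of `A ^ (r - 1)` to `s ^ (r - 1)`.
  set A := s * (1 + K / n) ^ (1 / (α - 1)) with hA
  have hxA : ∀ w, x w ≤ A := by
    intro w
    refine (Real.rpow_le_rpow_iff (hx.1 w) (by positivity) hα1).1 ((hup w).trans_eq ?_)
    rw [hA, Real.mul_rpow hs0.le (by positivity), ← Real.rpow_mul (x := 1 + K / n) (by positivity),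
      one_div_mul_cancel hα1.ne', Real.rpow_one]
  have hAB : A ^ (r - 1) = s ^ (r - 1) * B := by
    rw [hA, mul_pow, hB, ← Real.rpow_natCast ((1 + K / n) ^ (1 / (α - 1))),
      ← Real.rpow_mul (x := 1 + K / n) (by positivity), Nat.cast_sub hr1, Nat.cast_one, hp,
      one_div_mul_eq_div]
  have hdeg := mul_rpow_le_degree_mul_pow hα hr hx hxA v
  rw [hAB] at hdeg
  have hchoose : (r : ℝ) * n.choose r = n.choose (r - 1) * (n - (r - 1)) := by
    have := Nat.choose_succ_right_eq n (r - 1)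
    rw [Nat.sub_add_cancel hr1] at this
    have h2 : ((n.choose r * r : ℕ) : ℝ) = ((n.choose (r - 1) * (n - (r - 1)) : ℕ) : ℝ) := by
      rw [this]
    rw [Nat.cast_mul, Nat.cast_mul, Nat.cast_sub (by omega), Nat.cast_sub hr1,
      Nat.cast_one] at h2
    linarith
  set π := edgeDensity (Col P)
  set c := (n.choose (r - 1) : ℝ)
  have hc0 : 0 ≤ c := by positivity
  have hmain : π * c * ((1 - (r - 1) / n) * (1 - K / n)) ≤ G.degree v * B := by
    have hfs : (0 : ℝ) < r.factorial * s ^ (r - 1) := by positivity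
    refine le_of_mul_le_mul_left ?_ hfs
    calc _ = r.factorial * π * (1 - K / n) * (c * (n - (r - 1))) * (s ^ (r - 1) / n) := by
          field_simp
      _ = r * (r.factorial * (π * n.choose r) * s ^ r) * (s ^ (α - 1) * (1 - K / n)) := by
          rw [← hchoose, ← hsα]
          ring
      _ ≤ r * G.spectralRadius α * x v ^ (α - 1) := by
          have h1 : 0 ≤ s ^ (α - 1) * (1 - K / n) :=
            mul_nonneg (by positivity) (by linarith)
          have h2 : 0 ≤ G.spectralRadius α := le_trans (by positivity) hΛ
          gcongr
          exact hlow v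
      _ ≤ _ := hdeg
      _ = _ := by ring
  have ha0 : 0 ≤ ((r : ℝ) - 1) / n := div_nonneg (by linarith) hn'.le
  have ha1 : ((r : ℝ) - 1) / n ≤ 1 := (div_le_one hn').2 (by linarith)
  have hb1 : 0 ≤ p * (K / n) := by positivity
  set q := (1 - ((r : ℝ) - 1) / n) * (1 - K / n) with hq
  have hq0 : 0 ≤ q := mul_nonneg (by linarith) (by linarith)
  have hq1 : q ≤ 1 := mul_le_one₀ (by linarith) (by linarith) (by linarith)
  have hq2 : 1 - (r - 1) / n - K / n ≤ q := by
    have := mul_nonneg ha0 hKn0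
    rw [hq]
    linarith
  have hfin : 1 - ((r - 1) + K + p * K) / n ≤ q * B⁻¹ := by
    calc 1 - ((r - 1) + K + p * K) / n = (1 - (r - 1) / n - K / n) - p * (K / n) := by ring
      _ ≤ q - q * (p * (K / n)) := by
          have := mul_le_of_le_one_left hb1 hq1
          linarith
      _ = q * (1 - p * (K / n)) := by ring
      _ ≤ q * B⁻¹ := by gcongr
  calc _ = π * c * (1 - ((r - 1) + K + p * K) / n) := by ring
    _ ≤ π * c * (q * B⁻¹) := by gcongr
    _ = π * c * q * B⁻¹ := by ring
    _ ≤ G.degree v * B * B⁻¹ := by gcongr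
    _ = G.degree v := by field_simp

end Extremal

end UniformHypergraph

/-! ### The growth of the maximum spectral radius -/

/-- For a principal eigenvector of an extremal graph, cloning a vertex of a largest colour class
gives the required growth of the maximum spectral radius. -/
theorem maxSpectralRadius_succ_ge {r n : ℕ} {P : Pattern r} {α : ℝ} (hα : 1 < α) (hr : r ≠ 0)
    (hn : P.l * r < n) (hnl : P.l / (α - 1) ≤ (n : ℝ)) {G : UniformHypergraph (Fin n) r}
    (hG : G ∈ spectralExtremal α (Col P) n) (hpos : 0 < G.spectralRadius α) :
    (1 + (r : ℝ) * (1 - 1 / α - (P.l : ℝ) / (α * ((n : ℝ) - (P.l : ℝ) * (r : ℝ) + (P.l : ℝ)))) *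
      (G.xMin α) ^ α) * G.spectralRadius α ≤ maxSpectralRadius α (Col P) (n + 1) := by
  have hα0 : 0 < α := by linarith
  have hα1 : 0 < α - 1 := by linarith
  have hl : (0 : ℝ) < P.l := by exact_mod_cast P.l_pos
  have hn0 : 0 < n := by omega
  have hn' : (0 : ℝ) < n := by exact_mod_cast hn0
  have : Nonempty (Fin n) := ⟨⟨0, hn0⟩⟩
  have : Nonempty (Fin P.l) := ⟨⟨0, P.l_pos⟩⟩
  obtain ⟨φ, hφ, hsub⟩ := UniformHypergraph.principal_complete_of_extremal hα0 hG
  have hφG : (UniformHypergraph.complete P φ).spectralRadius α = G.spectralRadius α :=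
    hφ.trans hG.2.symm
  obtain ⟨x, hxG⟩ := G.principalEigenvectors_nonempty hα0
  have hx := hsub hxG
  -- A largest colour class.
  obtain ⟨i, hi⟩ : ∃ i, (n : ℝ) ≤ P.l * ((Finset.univ.filter fun v => φ v = i).card : ℝ) := by
    obtain ⟨i, -, hi⟩ := Finset.exists_le_card_fiber_of_nsmul_le_card_of_maps_to
      (s := (Finset.univ : Finset (Fin n))) (t := (Finset.univ : Finset (Fin P.l))) (f := φ)
      (b := (n : ℝ) / P.l) (fun _ _ => Finset.mem_univ _) Finset.univ_nonempty
      (by simp only [Finset.card_univ, Fintype.card_fin, nsmul_eq_mul]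
          exact (mul_div_cancel₀ _ hl.ne').le)
    exact ⟨i, by rwa [div_le_iff₀' hl] at hi⟩
  set m := (Finset.univ.filter fun v => φ v = i).card with hm
  have hm' : (0 : ℝ) < m := pos_of_mul_pos_right (hn'.trans_le hi) hl.le
  have hm0 : 0 < m := by exact_mod_cast hm'
  obtain ⟨v, hv⟩ := Finset.card_pos.1 hm0
  have hvi : φ v = i := (Finset.mem_filter.1 hv).2
  have hc : 0 ≤ 1 - 1 / α - 1 / (α * m) := by
    have h1 : 1 ≤ m * (α - 1) := by
      rw [div_le_iff₀ hα1] at hnl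
      refine le_of_mul_le_mul_left ?_ hl
      calc P.l * 1 ≤ n * (α - 1) := by linarith
        _ ≤ P.l * m * (α - 1) := by gcongr
        _ = _ := by ring
    have h2 : 1 - 1 / α - 1 / (α * m) = (m * (α - 1) - 1) / (α * m) := by field_simp
    rw [h2]
    exact div_nonneg (by linarith) (by positivity)
  have hclone := UniformHypergraph.spectralRadius_clone_ge hα hr hx
    (fun w hw => UniformHypergraph.principal_eq_of_color_eq hα hr hx (hφG ▸ hpos)
      (hw.trans hvi.symm)) hm.symm hm0 hc
  refine le_trans ?_ (hclone.trans
    (spectralRadius_le_maxSpectralRadius α (complete_mem_Col _)))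
  rw [hφG]
  have hcoef : 1 / (α * m) ≤ P.l / (α * ((n : ℝ) - P.l * r + P.l)) := by
    have hln : (P.l : ℝ) * r < n := by exact_mod_cast hn
    have hlr : (P.l : ℝ) ≤ P.l * r :=
      le_mul_of_one_le_right hl.le (by exact_mod_cast Nat.one_le_iff_ne_zero.2 hr)
    rw [div_le_div_iff₀ (by positivity) (mul_pos hα0 (by linarith))]
    calc 1 * (α * ((n : ℝ) - P.l * r + P.l)) ≤ α * (P.l * m) := by
          rw [one_mul]
          gcongr
          linarith
      _ = _ := by ring
  have hx0 := UniformHypergraph.xMin_nonneg hα0 G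
  have hxle := UniformHypergraph.xMin_le hxG v
  have hpow : G.xMin α ^ α ≤ x v ^ α := by gcongr
  have hpow0 : 0 ≤ G.xMin α ^ α := by positivity
  refine mul_le_mul_of_nonneg_right ?_ hpos.le
  have : (1 - 1 / α - (P.l : ℝ) / (α * ((n : ℝ) - P.l * r + P.l))) * G.xMin α ^ α ≤
      (1 - 1 / α - 1 / (α * m)) * x v ^ α :=
    (mul_le_mul_of_nonneg_right (by linarith) hpow0).trans
      (mul_le_mul_of_nonneg_left hpow hc)
  rw [mul_assoc, mul_assoc]
  gcongr

theorem mainTheorem2 (r : ℕ) (hr : 1 ≤ r) (P : Pattern r) (hP : P.E.Nonempty)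
    (α : ℝ) (hα : 1 < α) :
    Tendsto (fun n : ℕ => (exNumber (Col P) n : ℝ) / (n.choose r : ℝ)) atTop
      (𝓝 (edgeDensity (Col P))) ∧
    ∃ (n₁ : ℕ) (M : ℝ), 0 < M ∧
      ∀ n : ℕ, n₁ ≤ n → ∀ G ∈ spectralExtremal α (Col P) n,
        (∀ G' ∈ spectralExtremal α (Col P) (n + 1),
          G'.spectralRadius α ≥
            (1 + (r : ℝ) * (1 - 1 / α - (P.l : ℝ) /
              (α * ((n : ℝ) - (P.l : ℝ) * (r : ℝ) + (P.l : ℝ)))) * (G.xMin α) ^ α) *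
              G.spectralRadius α) ∧
        (G.xMin α) ^ α ≥
          1 / (n : ℝ) * (1 - edgeDensity (Col P) * M / ((r : ℝ) * (n : ℝ))) ∧
        (G.minDegree : ℝ) ≥
          edgeDensity (Col P) * (1 - M / (n : ℝ)) * (n.choose (r - 1) : ℝ) := by
  refine ⟨tendsto_edgeDensity P, ?_⟩
  have hr0 : r ≠ 0 := by omega
  have hα0 : 0 < α := by linarith
  have hα1 : 0 < α - 1 := by linarith
  have hr1 : (1 : ℝ) ≤ r := by exact_mod_cast hr
  have hπ := edgeDensity_pos hr0 hP
  -- `K` controls the spread of the entries, `K₁` the smallest entry and `K₂` the degrees.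
  obtain ⟨K, hK⟩ : ∃ K : ℝ, K = r.factorial * 2 ^ r / (r * edgeDensity (Col P)) := ⟨_, rfl⟩
  have hK0 : 0 ≤ K := by rw [hK]; positivity
  set K₁ := α / (α - 1) * K with hK₁
  set K₂ := ((r : ℝ) - 1) + K + (r - 1) / (α - 1) * K with hK₂
  have hK₁0 : 0 ≤ K₁ := by positivity
  have hK₂0 : 0 ≤ K₂ := by
    have : (0 : ℝ) ≤ r - 1 := by linarith
    positivity
  refine ⟨2 * r + P.l * r + 1 + ⌈K⌉₊ + ⌈K₁⌉₊ + ⌈P.l / (α - 1)⌉₊,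
    r * K₁ / edgeDensity (Col P) + K₂ + 1, by positivity, fun n hn G hG => ?_⟩
  have hn0 : 0 < n := by omega
  have hn' : (0 : ℝ) < n := by exact_mod_cast hn0
  have hKn : K ≤ n := (Nat.le_ceil K).trans (by exact_mod_cast (by omega : ⌈K⌉₊ ≤ n))
  have hK₁n : K₁ ≤ n := (Nat.le_ceil K₁).trans (by exact_mod_cast (by omega : ⌈K₁⌉₊ ≤ n))
  have hln : P.l / (α - 1) ≤ (n : ℝ) :=
    (Nat.le_ceil _).trans (by exact_mod_cast (by omega : ⌈P.l / (α - 1)⌉₊ ≤ n))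
  have h2r : 2 * r ≤ n := by omega
  have : Nonempty (Fin n) := ⟨⟨0, hn0⟩⟩
  have hpos : 0 < G.spectralRadius α := by
    rw [hG.2]
    refine lt_of_lt_of_le ?_ (le_maxSpectralRadius P hα0 (by omega) hn0)
    have : (0 : ℝ) < n.choose r := by exact_mod_cast Nat.choose_pos (by omega)
    positivity
  obtain ⟨φ, hφ, hsub⟩ := UniformHypergraph.principal_complete_of_extremal hα0 hG
  have hentries := fun x (hx : x ∈ G.principalEigenvectors α) w =>
    UniformHypergraph.entries_of_principal hα hr0 hπ h2r hφ (hsub hx) w hK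
  refine ⟨fun G' hG' => ?_, ?_, ?_⟩
  · rw [hG'.2]
    exact maxSpectralRadius_succ_ge hα hr0 (by omega) hln hG hpos
  · have hK₁n' : K₁ / n ≤ 1 := (div_le_one hn').2 hK₁n
    have h1 : 1 / (n : ℝ) * (1 - K₁ / n) ≤ G.xMin α ^ α :=
      UniformHypergraph.le_xMin_rpow hα0 (mul_nonneg (by positivity) (by linarith))
        fun x hx w => UniformHypergraph.rpow_ge_of_entry_ge hα hn0 hKn (hx.1 w)
          (hentries x hx w).1
    refine le_trans ?_ h1
    have h2 : K₁ / n ≤ edgeDensity (Col P) *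
        (r * K₁ / edgeDensity (Col P) + K₂ + 1) / (r * n) := by
      rw [div_le_div_iff₀ hn' (by positivity)]
      have h3 : edgeDensity (Col P) * (r * K₁ / edgeDensity (Col P) + K₂ + 1) =
          r * K₁ + edgeDensity (Col P) * (K₂ + 1) := by field_simp; ring
      rw [h3]
      have : 0 ≤ edgeDensity (Col P) * (K₂ + 1) * n := by positivity
      linarith
    gcongr
  · obtain ⟨v, hv⟩ := G.exists_minDegree_eq_degree
    obtain ⟨x, hx⟩ := G.principalEigenvectors_nonempty hα0
    have h1 := UniformHypergraph.degree_ge_of_principal hα hr0 hπ h2r hx hG.2 hK0 hKn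
      (fun w => (hentries x hx w).1) (fun w => (hentries x hx w).2) v
    rw [hv]
    refine le_trans ?_ h1
    have h2 : K₂ ≤ r * K₁ / edgeDensity (Col P) + K₂ + 1 := by
      have : 0 ≤ r * K₁ / edgeDensity (Col P) := by positivity
      linarith
    gcongr
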